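/- Let $G$ be a connected Lie group of dimension $n+2$ ($n\ge 0$) with a left-invariant Riemannian metric $g$, and let $K\subset G$ be a closed connected Lie subgroup of dimension $n$ whose Lie algebra $\mathfrak k$ is semisimple. Let $\mathcal V$ be the tangent distribution of the foliation $\mathcal F$ of $G$ by the left cosets of $K$, i.e. $\mathcal V_p=dL_p(\mathfrak k)$, let $\mathcal H=\mathcal V^{\perp}$, and denote by $\mathcal V,\mathcal H$ also the orthogonal projections. Assume that $\mathcal F$ is conformal: with $\nabla$ the Levi-Civita connection of $g$, there is a smooth vector field $V_0$ in $\mathcal V$ such that $\tfrac12\mathcal V(\nabla_XY+\nabla_YX)=g(X,Y)\,V_0$ for all smooth vector fields $X,Y$ in $\mathcal H$. Then: 1. There is a unique smooth structure (of a surface) on the leaf space $L^2=G/K$, equipped with the quotient topology, for which the projection $\pi:G\to G/K$ is a smooth submersion. 2. There is a unique Riemannian metric $h$ on $L^2$ such that $\pi:(G,g)\to(L^2,h)$ is a Riemannian submersion. 3. There are an orthonormal basis $\{X,Y\}$ of $\mathcal H_e\subset\mathfrak g=T_eG$ and a real number $\rho$ with $\mathcal H[X,Y]=\rho X$; and for every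 such $X,Y,\rho$, the Gaussian curvature of $(L^2,h)$ is constant, equal to $-\rho^2\le 0$. -/

import Mathlib

open Bundle Manifold
open scoped ContDiff

noncomputable section

namespace LeafSpace

/-- The model space of `n`-dimensional manifolds. -/
abbrev Eucl (n : ℕ) : Type := EuclideanSpace ℝ (Fin n)

section Riemannian

variable {n : ℕ} {M : Type*} [TopologicalSpace M] [ChartedSpace (Eucl n) M]
  [IsManifold (𝓡 n) ∞ M]

/-- `X` is a smooth vector field on the set `U` (to be used for open `U`). -/
def SmoothFieldOn (X : ∀ p : M, TangentSpace (𝓡 n) p) (U : Set M) : Prop :=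
  ContMDiffOn (𝓡 n) (𝓡 n).tangent ∞ (fun p => (⟨p, X p⟩ : TangentBundle (𝓡 n) M)) U

/-- `X` is a vector field that is differentiable at `p`. -/
def FieldDifferentiableAt (X : ∀ p : M, TangentSpace (𝓡 n) p) (p : M) : Prop :=
  MDifferentiableAt (𝓡 n) (𝓡 n).tangent (fun q => (⟨q, X q⟩ : TangentBundle (𝓡 n) M)) p

variable (n M) in
/-- Smooth Riemannian metrics on the `n`-dimensional manifold `M`. -/
abbrev Metric : Type _ :=
  ContMDiffRiemannianMetric (𝓡 n) ∞ (Eucl n) (fun p : M => TangentSpace (𝓡 n) p)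

variable (n M) in
/-- Affine connections on `M`; `∇_X Y` at `p` is `nabla Y p (X p)`. -/
abbrev Connection : Type _ :=
  CovariantDerivative (𝓡 n) (Eucl n) (fun p : M => TangentSpace (𝓡 n) p)

/-- `nabla` is the Levi-Civita connection of `g`: it is torsion-free and
`X (g(Y, Z)) = g(∇_X Y, Z) + g(Y, ∇_X Z)`. -/
structure IsLeviCivita (g : Metric n M) (nabla : Connection n M) : Prop where
  torsion_free : nabla.torsion = 0
  metric : ∀ (X Y Z : ∀ p : M, TangentSpace (𝓡 n) p) (p : M),
    FieldDifferentiableAt Y p → FieldDifferentiableAt Z p →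
      mvfderiv (𝓡 n) (fun q => g.inner q (Y q) (Z q)) p (X p) =
        g.inner p (nabla Y p (X p)) (Z p) + g.inner p (Y p) (nabla Z p (X p))

/-- The curvature `R(X, Y) Z = ∇_X ∇_Y Z - ∇_Y ∇_X Z - ∇_[X, Y] Z`. -/
def curvature (nabla : Connection n M) (X Y Z : ∀ p : M, TangentSpace (𝓡 n) p) (p : M) :
    TangentSpace (𝓡 n) p :=
  nabla (fun q => nabla Z q (Y q)) p (X p) - nabla (fun q => nabla Z q (X q)) p (Y p) -
    nabla Z p (VectorField.mlieBracket (𝓡 n) X Y p)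

/-- The orthogonal complement, in `T_p M`, of a subspace of `T_p M`. -/
def orthogonal (g : Metric n M) (p : M) (W : Submodule ℝ (TangentSpace (𝓡 n) p)) :
    Submodule ℝ (TangentSpace (𝓡 n) p) where
  carrier := {v | ∀ w ∈ W, g.inner p v w = 0}
  add_mem' := by
    intro a b ha hb w hw
    have h1 := ha w hw
    have h2 := hb w hw
    simp [h1, h2]
  zero_mem' := by
    intro w _
    simp
  smul_mem' := by
    intro c a ha w hw
    have h1 := ha w hw
    simp [h1]

/-- `u` is the component of `v ∈ T_p M` in `W`, with respect to the orthogonal decomposition of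
`T_p M` into `W` and its orthogonal complement. -/
def IsComponent (g : Metric n M) (p : M) (W : Submodule ℝ (TangentSpace (𝓡 n) p))
    (v u : TangentSpace (𝓡 n) p) : Prop :=
  u ∈ W ∧ v - u ∈ orthogonal g p W

/-- The distribution `V`, with orthogonal complement `H`, is conformal: there is a smooth vector
field `V₀` in `V` with `B(X, Y) = g(X, Y) V₀` for all vector fields `X, Y` in `H`, where `B`, the
second fundamental form of `H`, sends `X, Y` to the `V`-component of `(∇_X Y + ∇_Y X) / 2`. -/
def IsConformal (g : Metric n M) (V : ∀ p : M, Submodule ℝ (TangentSpace (𝓡 n) p)) : Prop :=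
  ∃ nabla : Connection n M, IsLeviCivita g nabla ∧
    ∃ V₀ : ∀ p : M, TangentSpace (𝓡 n) p, SmoothFieldOn V₀ Set.univ ∧ (∀ p, V₀ p ∈ V p) ∧
      ∀ X Y : ∀ p : M, TangentSpace (𝓡 n) p,
        SmoothFieldOn X Set.univ → SmoothFieldOn Y Set.univ →
        (∀ p, X p ∈ orthogonal g p (V p)) → (∀ p, Y p ∈ orthogonal g p (V p)) →
        ∀ p, IsComponent g p (V p) ((1 / 2 : ℝ) • (nabla Y p (X p) + nabla X p (Y p)))
          (g.inner p (X p) (Y p) • V₀ p)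

end Riemannian

/-- The function `κ` is the Gaussian curvature of the surface `(L, h)`: for the Levi-Civita
connection of `h`, one has `h(R(X, Y) Y, X) = κ (h(X, X) h(Y, Y) - h(X, Y)²)`
for all local vector fields. -/
def IsGaussianCurvature {L : Type*} [TopologicalSpace L] [ChartedSpace (Eucl 2) L]
    [IsManifold (𝓡 2) ∞ L] (h : Metric 2 L) (κ : L → ℝ) : Prop :=
  ∃ nabla : Connection 2 L, IsLeviCivita h nabla ∧
    ∀ (U : Set L), IsOpen U → ∀ X Y : ∀ p : L, TangentSpace (𝓡 2) p,
      SmoothFieldOn X U → SmoothFieldOn Y U → ∀ p ∈ U,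
        h.inner p (curvature nabla X Y Y p) (X p) =
          κ p * (h.inner p (X p) (X p) * h.inner p (Y p) (Y p) - h.inner p (X p) (Y p) ^ 2)

/-- `φ : (M, g) → (L, h)` is a Riemannian submersion: a smooth submersion whose differential at
each point is isometric on the orthogonal complement of its kernel. -/
structure IsRiemannianSubmersion {m l : ℕ} {M L : Type*}
    [TopologicalSpace M] [ChartedSpace (Eucl m) M] [IsManifold (𝓡 m) ∞ M]
    [TopologicalSpace L] [ChartedSpace (Eucl l) L] [IsManifold (𝓡 l) ∞ L]
    (g : Metric m M) (h : Metric l L) (φ : M → L) : Prop where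
  submersion : IsSubmersion (𝓡 m) (𝓡 l) ∞ φ
  isometric : ∀ (p : M) (v w : TangentSpace (𝓡 m) p),
    v ∈ orthogonal g p (LinearMap.ker (mfderiv (𝓡 m) (𝓡 l) φ p).toLinearMap) →
    w ∈ orthogonal g p (LinearMap.ker (mfderiv (𝓡 m) (𝓡 l) φ p).toLinearMap) →
      h.inner (φ p) (mfderiv (𝓡 m) (𝓡 l) φ p v) (mfderiv (𝓡 m) (𝓡 l) φ p w) = g.inner p v w

/-- A smooth real Lie group is regular enough for Mathlib's Lie bracket on `T_1 G`. -/
instance instLieGroupMinSmoothness {n : ℕ} {G : Type*} [TopologicalSpace G]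
    [ChartedSpace (Eucl n) G] [Group G] [LieGroup (𝓡 n) ∞ G] :
    LieGroup (𝓡 n) (minSmoothness ℝ 3) G :=
  LieGroup.of_le (n := ∞) (by simp only [minSmoothness_of_isRCLikeNormedField]; exact ENat.LEInfty.out)

section Group

variable {n : ℕ} {G : Type*} [TopologicalSpace G] [ChartedSpace (Eucl n) G] [Group G]

/-- The metric `g` is left-invariant: all left translations are isometries. -/
def IsLeftInvariant [IsManifold (𝓡 n) ∞ G] (g : Metric n G) : Prop :=
  ∀ (a b : G) (v w : TangentSpace (𝓡 n) b),
    g.inner (a * b) (mfderiv (𝓡 n) (𝓡 n) (fun x => a * x) b v)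
      (mfderiv (𝓡 n) (𝓡 n) (fun x => a * x) b w) = g.inner b v w

/-- The Lie algebra of the Lie subgroup `K`, as a subspace of the Lie algebra of `G`. -/
def lieAlgebraOf (m : ℕ) (K : Subgroup G) [ChartedSpace (Eucl m) K] :
    Submodule ℝ (GroupLieAlgebra (𝓡 n) G) :=
  LinearMap.range (mfderiv (𝓡 m) (𝓡 n) (Subtype.val : K → G) 1).toLinearMap

/-- The tangent distribution of the foliation of `G` by the left cosets of `K`: its value at `p`
is the image of the Lie algebra of `K` under the differential of left translation by `p`. -/
def leafDistribution (m : ℕ) (K : Subgroup G) [ChartedSpace (Eucl m) K] (p : G) :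
    Submodule ℝ (TangentSpace (𝓡 n) p) where
  carrier := {w | ∃ v ∈ lieAlgebraOf (n := n) m K, mulInvariantVectorField v p = w}
  add_mem' := by
    rintro _ _ ⟨v, hv, rfl⟩ ⟨w, hw, rfl⟩
    exact ⟨v + w, add_mem hv hw, congrFun (mulInvariantVectorField_add v w) p⟩
  zero_mem' := ⟨0, zero_mem _, by
    simpa using congrFun (mulInvariantVectorField_smul (0 : ℝ) (0 : GroupLieAlgebra (𝓡 n) G)) p⟩
  smul_mem' := by
    rintro c _ ⟨v, hv, rfl⟩
    exact ⟨c • v, Submodule.smul_mem _ c hv, congrFun (mulInvariantVectorField_smul c v) p⟩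

/-- `X, Y` is an orthonormal basis of the horizontal space at the identity, the orthogonal
complement of the Lie algebra of `K` (here of dimension two), and the horizontal component
of `[X, Y]` is `ρ X`. -/
structure IsAdaptedFrame (m : ℕ) [LieGroup (𝓡 n) ∞ G] (g : Metric n G) (K : Subgroup G)
    [ChartedSpace (Eucl m) K] (X Y : GroupLieAlgebra (𝓡 n) G) (ρ : ℝ) : Prop where
  horizontal_left : X ∈ orthogonal g 1 (leafDistribution m K 1)
  horizontal_right : Y ∈ orthogonal g 1 (leafDistribution m K 1)
  norm_left : g.inner 1 X X = 1
  norm_right : g.inner 1 Y Y = 1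
  inner_eq_zero : g.inner 1 X Y = 0
  bracket : IsComponent g 1 (orthogonal g 1 (leafDistribution m K 1)) ⁅X, Y⁆ (ρ • X)

/-- `cs` is a smooth structure (of a surface) on the topological space `G ⧸ K` for which the
projection `G → G ⧸ K` is a smooth submersion. -/
structure IsLeafSpaceStructure (K : Subgroup G) (cs : ChartedSpace (Eucl 2) (G ⧸ K)) : Prop where
  isManifold : IsManifold (𝓡 2) ∞ (G ⧸ K)
  submersion : IsSubmersion (𝓡 n) (𝓡 2) ∞ (QuotientGroup.mk : G → G ⧸ K)

end Group

/-- Two atlases on the same space define the same smooth structure. -/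
def SameSmoothStructure {n : ℕ} {M : Type*} [TopologicalSpace M]
    (cs cs' : ChartedSpace (Eucl n) M) : Prop :=
  @IsManifold.maximalAtlas ℝ _ (Eucl n) _ _ (Eucl n) _ (𝓡 n) ∞ M _ cs =
    @IsManifold.maximalAtlas ℝ _ (Eucl n) _ _ (Eucl n) _ (𝓡 n) ∞ M _ cs'

end LeafSpace

end

/-!
The theorem rests on one algebraic fact: the Lie algebra `𝔨` of `K` is an ideal of the Lie algebra
`𝔤` of `G`. For left-invariant horizontal fields `X, Y` and a vertical one `U`, the Koszul formula
turns conformality into `g(Y, [U, X]) + g(X, [U, Y]) = g(X, Y) l(U)`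
(`IsConformal.inner_lie_add_inner_lie`), that is, `𝔨` acts on the plane `𝔤/𝔨` by conformal
matrices. In dimension two these commute, and a semisimple Lie algebra is perfect
(`span_lie_eq_top_of_isSemisimple`), so `𝔨` acts trivially on `𝔤/𝔨`
(`lie_mem_of_conformal_action`, `lie_mem_lieAlgebraOf_of_isConformal`).

*The smooth structure.* A slice `σ` of `K` at the identity gives coordinates `(u, y) ↦ σ y * κ u`
of `G`, by the inverse function theorem (`exists_sliceChart`). The slice is a chart of `G ⧸ K` and
its translates are an atlas (`exists_chartedSpace_quotient`). A submersion has local sections, so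
that maps out of its image are smooth when their pullbacks are (`ContMDiff.of_comp_isSubmersion`);
this gives uniqueness (`maximalAtlas_eq_of_isSubmersion`).

*The metric.* As `𝔨` is an ideal, a left-invariant field `v` of `G` descends to the leaf space: for
`f` pulled back from the quotient and `U` in `𝔨`, `U (v f) = v (U f) + [U, v] f = 0`, so `v f` is
constant along the leaves, which are connected (`mfderiv_mk_mulInvariantVectorField_congr`). Here
`[U, v] f = U (v f) - v (U f)` is `mvfderiv_mlieBracket`. An orthonormal basis `X, Y` of the
horizontal space at the identity thus induces a frame of the leaf space, and the projection is a
Riemannian submersion exactly for the metric in which this frame is orthonormal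
(`IsHorizontalBasis.isRiemannianSubmersion`, `IsHorizontalBasis.isOrthonormalFrame`).

*The curvature.* A rotation of the basis makes the horizontal part of `[X, Y]` equal to `ρ X`. The
induced frame `e₁, e₂` then satisfies `[e₁, e₂] = ρ e₁`, since brackets of related fields are
related (`mfderiv_mlieBracket_of_related`). For such a frame the Levi-Civita connection is explicit,
with `∇_v e₁ = -ρ ⟨v, e₁⟩ e₂` and `∇_v e₂ = ρ ⟨v, e₁⟩ e₁`, and its curvature is `-ρ ^ 2`
(`IsBracketFrame.isGaussianCurvature`).
-/

/-! ### Vector fields, functions and brackets -/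

namespace LeafSpace

open VectorField Filter Topology

section Bracket

variable {E : Type*} [NormedAddCommGroup E] [NormedSpace ℝ E]
  {H : Type*} [TopologicalSpace H] {I : ModelWithCorners ℝ E H}
  {M : Type*} [TopologicalSpace M] [ChartedSpace H M] [IsManifold I ∞ M]
  {E' : Type*} [NormedAddCommGroup E'] [NormedSpace ℝ E']
  {H' : Type*} [TopologicalSpace H'] {J : ModelWithCorners ℝ E' H'}
  {N : Type*} [TopologicalSpace N] [ChartedSpace H' N] [IsManifold J ∞ N]

/-- The image of a smooth vector field under the differential of a smooth map is a smooth section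
along the map. -/
theorem contMDiffAt_mfderiv_section {k : ℕ∞ω} {f : M → N} {x : M}
    {Y : ∀ q : M, TangentSpace I q} (hf : ContMDiffAt I J ∞ f x) (hk : k + 1 ≤ ∞)
    (hY : ContMDiffAt I I.tangent k (fun q => (⟨q, Y q⟩ : TangentBundle I M)) x) :
    ContMDiffAt I J.tangent k
      (fun q => (⟨f q, mfderiv I J f q (Y q)⟩ : TangentBundle J N)) x := by
  have hk' : k ≤ ∞ := le_trans le_self_add hk
  have : IsManifold I (k + 1) M := IsManifold.of_le hk
  exact ContMDiffAt.clm_apply_of_inCoordinates (hf.mfderiv_const hk) hY (hf.of_le hk')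

/-- The derivative of a smooth function along a smooth vector field is smooth. -/
theorem contMDiffAt_mvfderiv_apply {k : ℕ∞ω} {u : M → ℝ} {x : M}
    {Y : ∀ q : M, TangentSpace I q} (hu : ContMDiffAt I 𝓘(ℝ) ∞ u x) (hk : k + 1 ≤ ∞)
    (hY : ContMDiffAt I I.tangent k (fun q => (⟨q, Y q⟩ : TangentBundle I M)) x) :
    ContMDiffAt I 𝓘(ℝ) k (fun q => mvfderiv I u q (Y q)) x := by
  have h := contMDiffAt_mfderiv_section hu hk hY
  rw [contMDiffAt_totalSpace] at h
  simpa [mvfderiv] using! h.2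

theorem ContMDiffAt.eventually_mdifferentiableAt {f : M → N} {x : M}
    (hf : ContMDiffAt I J ∞ f x) : ∀ᶠ y in 𝓝 x, MDifferentiableAt I J f y := by
  filter_upwards [(contMDiffAt_iff_contMDiffAt_nhds (n := 1) (by simp)).1
    (hf.of_le ENat.LEInfty.out)] with y hy
  exact hy.mdifferentiableAt one_ne_zero

omit [IsManifold I ∞ M] in
theorem mvfderiv_congr {F : Type*} [NormedAddCommGroup F] [NormedSpace ℝ F] {f f' : M → F} {x : M}
    (h : f =ᶠ[𝓝 x] f') : mvfderiv I f x = mvfderiv I f' x := by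
  ext z
  exact congrArg (fun L : TangentSpace I x →L[ℝ] F => L z) h.mfderiv_eq

variable [CompleteSpace E]

/-- Vector fields act on functions as derivations, and the bracket acts as the commutator. The
identity is obtained by comparing the coefficients of `Z` in the Jacobi identity for
`X`, `Y`, `u • Z`, where `Z` is any field that does not vanish at the point. -/
theorem mvfderiv_mlieBracket {X Y : ∀ q : M, TangentSpace I q} {u : M → ℝ} {x : M}
    (hX : ContMDiffAt I I.tangent ∞ (fun q => (⟨q, X q⟩ : TangentBundle I M)) x)
    (hY : ContMDiffAt I I.tangent ∞ (fun q => (⟨q, Y q⟩ : TangentBundle I M)) x)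
    (hu : ContMDiffAt I 𝓘(ℝ) ∞ u x) :
    mvfderiv I u x (mlieBracket I X Y x) =
      mvfderiv I (fun q => mvfderiv I u q (Y q)) x (X x) -
        mvfderiv I (fun q => mvfderiv I u q (X q)) x (Y x) := by
  by_cases hE : Subsingleton (TangentSpace I x)
  · rw [Subsingleton.elim (mlieBracket I X Y x) 0, Subsingleton.elim (X x) 0,
      Subsingleton.elim (Y x) 0]
    simp
  rw [not_subsingleton_iff_nontrivial] at hE
  obtain ⟨z, hz⟩ := exists_ne (0 : TangentSpace I x)
  set Z : ∀ q : M, TangentSpace I q := FiberBundle.extend E z with hZdef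
  have hZx : Z x = z := FiberBundle.extend_apply_self E z
  have hZ : ContMDiffAt I I.tangent ∞ (fun q => (⟨q, Z q⟩ : TangentBundle I M)) x :=
    FiberBundle.contMDiffAt_extend I E z
  have : IsManifold I (minSmoothness ℝ 3) M := IsManifold.of_le (n := ∞)
    (by simpa using ENat.LEInfty.out)
  have h2 : minSmoothness ℝ 2 ≤ ∞ := by simpa using ENat.LEInfty.out
  have h2' : ((2 : ℕ∞) : ℕ∞ω) ≤ ∞ := ENat.LEInfty.out
  have : IsManifold I ((2 : ℕ∞) + 1) M :=
    IsManifold.of_le (n := ∞) (by exact_mod_cast le_top)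
  have huZ : ContMDiffAt I I.tangent ∞ (fun q => (⟨q, (u • Z) q⟩ : TangentBundle I M)) x :=
    hu.smul_section hZ
  have jac := leibniz_identity_mlieBracket_apply (hX.of_le h2) (hY.of_le h2) (huZ.of_le h2)
  have jacZ := leibniz_identity_mlieBracket_apply (hX.of_le h2) (hY.of_le h2) (hZ.of_le h2)
  have eX : mlieBracket I X (u • Z) =ᶠ[𝓝 x]
      ((fun q => mvfderiv I u q (X q)) • Z + u • mlieBracket I X Z) := by
    filter_upwards [ContMDiffAt.eventually_mdifferentiableAt hu,
      ContMDiffAt.eventually_mdifferentiableAt hZ] with q hq hq'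
    rw [mlieBracket_smul_right hq hq']; rfl
  have eY : mlieBracket I Y (u • Z) =ᶠ[𝓝 x]
      ((fun q => mvfderiv I u q (Y q)) • Z + u • mlieBracket I Y Z) := by
    filter_upwards [ContMDiffAt.eventually_mdifferentiableAt hu,
      ContMDiffAt.eventually_mdifferentiableAt hZ] with q hq hq'
    rw [mlieBracket_smul_right hq hq']; rfl
  have hXu : MDifferentiableAt I 𝓘(ℝ) (fun q => mvfderiv I u q (X q)) x :=
    (contMDiffAt_mvfderiv_apply hu (by simp) hX).mdifferentiableAt (by simp)
  have hYu : MDifferentiableAt I 𝓘(ℝ) (fun q => mvfderiv I u q (Y q)) x :=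
    (contMDiffAt_mvfderiv_apply hu (by simp) hY).mdifferentiableAt (by simp)
  have hud := hu.mdifferentiableAt (by simp : (∞ : ℕ∞ω) ≠ 0)
  have hZd := hZ.mdifferentiableAt (by simp : (∞ : ℕ∞ω) ≠ 0)
  have hXZ := ((hX.of_le h2').mlieBracket_vectorField (m := 1) (n := 2) (hZ.of_le h2')
    (by simp [one_add_one_eq_two])).mdifferentiableAt
    one_ne_zero
  have hYZ := ((hY.of_le h2').mlieBracket_vectorField (m := 1) (n := 2) (hZ.of_le h2')
    (by simp [one_add_one_eq_two])).mdifferentiableAt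
    one_ne_zero
  have hs (w : M → ℝ) (W : ∀ q : M, TangentSpace I q) (hw : MDifferentiableAt I 𝓘(ℝ) w x)
      (hW : MDifferentiableAt I I.tangent (fun q => (⟨q, W q⟩ : TangentBundle I M)) x) :
      MDifferentiableAt I I.tangent (fun q => (⟨q, (w • W) q⟩ : TangentBundle I M)) x :=
    hw.smul_section hW
  rw [Filter.EventuallyEq.rfl.mlieBracket_vectorField_eq eY,
    Filter.EventuallyEq.rfl.mlieBracket_vectorField_eq eX,
    mlieBracket_add_right (hs _ _ hYu hZd) (hs _ _ hud hYZ),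
    mlieBracket_add_right (hs _ _ hXu hZd) (hs _ _ hud hXZ),
    mlieBracket_smul_right hYu hZd, mlieBracket_smul_right hud hYZ,
    mlieBracket_smul_right hXu hZd, mlieBracket_smul_right hud hXZ,
    mlieBracket_smul_right hud hZd, jacZ] at jac
  -- In the Jacobi identity for `X`, `Y`, `u • Z` all terms cancel except the multiples of `Z` with
  -- second derivatives of `u` or a derivative along `[X, Y]`.
  have key : (mvfderiv I u x (mlieBracket I X Y x) -
      (mvfderiv I (fun q => mvfderiv I u q (Y q)) x (X x) -
        mvfderiv I (fun q => mvfderiv I u q (X q)) x (Y x))) • Z x = 0 := by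
    rw [← sub_eq_zero] at jac
    rw [← neg_eq_zero, ← jac]
    module
  rw [hZx] at key
  exact sub_eq_zero.1 ((smul_eq_zero.1 key).resolve_right hz)

omit [CompleteSpace E] in
/-- Smooth functions separate tangent vectors. -/
theorem tangentVector_ext {y : M} {v w : TangentSpace I y}
    (h : ∀ u : M → ℝ, ContMDiffAt I 𝓘(ℝ) ∞ u y → mvfderiv I u y v = mvfderiv I u y w) :
    v = w := by
  have hc : ContMDiffAt I 𝓘(ℝ, E) ∞ (extChartAt I y) y := contMDiffAt_extChartAt
  have hinj := (isInvertible_mfderiv_extChartAt (I := I) (mem_extChartAt_source y)).injective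
  apply hinj
  -- The coordinates followed by linear forms are enough functions.
  refine (SeparatingDual.eq_iff_forall_dual_eq (R := ℝ) (V := E)).2 fun l => ?_
  have hl : ContMDiffAt 𝓘(ℝ, E) 𝓘(ℝ) ∞ l (extChartAt I y y) := l.contMDiff.contMDiffAt
  have h1 := h (l ∘ extChartAt I y) (hl.comp y hc)
  have key (z : TangentSpace I y) : mvfderiv I (l ∘ extChartAt I y) y z =
      l (mfderiv I 𝓘(ℝ, E) (extChartAt I y) y z) := by
    rw [mvfderiv_comp_apply y (hl.mdifferentiableAt (by simp)) (hc.mdifferentiableAt (by simp))]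
    simp [mvfderiv, mfderiv_eq_fderiv]
    rfl
  rw [key, key] at h1
  exact h1

variable [CompleteSpace E']

/-- The brackets of vector fields related by a smooth map are related. -/
theorem mfderiv_mlieBracket_of_related {φ : M → N} {x : M}
    {X Y : ∀ q : M, TangentSpace I q} {X' Y' : ∀ q : N, TangentSpace J q}
    (hφ : ContMDiff I J ∞ φ)
    (hX : ContMDiffAt I I.tangent ∞ (fun q => (⟨q, X q⟩ : TangentBundle I M)) x)
    (hY : ContMDiffAt I I.tangent ∞ (fun q => (⟨q, Y q⟩ : TangentBundle I M)) x)
    (hX' : ContMDiffAt J J.tangent ∞ (fun q => (⟨q, X' q⟩ : TangentBundle J N)) (φ x))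
    (hY' : ContMDiffAt J J.tangent ∞ (fun q => (⟨q, Y' q⟩ : TangentBundle J N)) (φ x))
    (hXX' : ∀ q, mfderiv I J φ q (X q) = X' (φ q))
    (hYY' : ∀ q, mfderiv I J φ q (Y q) = Y' (φ q)) :
    mfderiv I J φ x (mlieBracket I X Y x) = mlieBracket J X' Y' (φ x) := by
  refine tangentVector_ext fun u hu => ?_
  have hd (q : M) : MDifferentiableAt I J φ q := hφ.mdifferentiable (by simp) q
  have hud := hu.mdifferentiableAt (by simp : (∞ : ℕ∞ω) ≠ 0)
  have comp {Z : ∀ q : M, TangentSpace I q} {Z' : ∀ q : N, TangentSpace J q}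
      (hZ : ∀ q, mfderiv I J φ q (Z q) = Z' (φ q)) :
      (fun q => mvfderiv I (u ∘ φ) q (Z q)) =ᶠ[𝓝 x]
        (fun q => mvfderiv J u q (Z' q)) ∘ φ := by
    filter_upwards [(hd x).continuousAt.eventually
      (ContMDiffAt.eventually_mdifferentiableAt hu)] with q hq
    rw [mvfderiv_comp_apply q hq (hd q), hZ]; rfl
  have comp2 {Z Z₁ : ∀ q : M, TangentSpace I q} {Z' Z₁' : ∀ q : N, TangentSpace J q}
      (hZ : ∀ q, mfderiv I J φ q (Z q) = Z' (φ q))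
      (hZ₁ : ∀ q, mfderiv I J φ q (Z₁ q) = Z₁' (φ q))
      (hs : ContMDiffAt J J.tangent ∞ (fun q => (⟨q, Z' q⟩ : TangentBundle J N)) (φ x)) :
      mvfderiv I (fun q => mvfderiv I (u ∘ φ) q (Z q)) x (Z₁ x) =
        mvfderiv J (fun q => mvfderiv J u q (Z' q)) (φ x) (Z₁' (φ x)) := by
    have h1 : mvfderiv I (fun q => mvfderiv I (u ∘ φ) q (Z q)) x =
        mvfderiv I ((fun q => mvfderiv J u q (Z' q)) ∘ φ) x := mvfderiv_congr (comp hZ)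
    rw [h1, mvfderiv_comp_apply x _ (hd x), hZ₁]
    exact (contMDiffAt_mvfderiv_apply hu (by simp) hs).mdifferentiableAt (by simp)
  rw [mvfderiv_mlieBracket hX' hY' hu, ← comp2 hXX' hYY' hX', ← comp2 hYY' hXX' hY',
    ← mvfderiv_comp_apply x hud (hd x),
    mvfderiv_mlieBracket hX hY (hu.comp x hφ.contMDiffAt)]

end Bracket
end LeafSpace

/-! ### Submersions and immersions -/

namespace LeafSpace

open Filter Topology

section Submersion

variable {E E' : Type*} [NormedAddCommGroup E] [NormedSpace ℝ E]
  [NormedAddCommGroup E'] [NormedSpace ℝ E']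
  {M N : Type*} [TopologicalSpace M] [ChartedSpace E M] [TopologicalSpace N] [ChartedSpace E' N]

/-- A submersion has a smooth local section through each point of its domain. -/
theorem exists_localSection_of_isSubmersionAt {f : M → N} {x : M}
    (hf : IsSubmersionAt 𝓘(ℝ, E) 𝓘(ℝ, E') ∞ f x) :
    ∃ s : N → M, s (f x) = x ∧ ContMDiffAt 𝓘(ℝ, E') 𝓘(ℝ, E) ∞ s (f x) ∧
      ∀ᶠ y in 𝓝 (f x), f (s y) = y := by
  set φ := hf.domChart
  set ψ := hf.codChart
  set e := hf.equiv
  have hφ : φ ∈ IsManifold.maximalAtlas 𝓘(ℝ, E) ∞ M := hf.domChart_mem_maximalAtlas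
  have hψ : ψ ∈ IsManifold.maximalAtlas 𝓘(ℝ, E') ∞ N := hf.codChart_mem_maximalAtlas
  have hx : x ∈ φ.source := hf.mem_domChart_source
  have hfx : f x ∈ ψ.source := hf.mem_codChart_source
  have hw (z : E) (hz : z ∈ φ.target) : ψ (f (φ.symm z)) = (e z).1 := by
    have hz' : z ∈ (φ.extend 𝓘(ℝ, E)).target := by simpa using hz
    simpa using! hf.writtenInCharts hz'
  have hw' : ψ (f x) = (e (φ x)).1 := by
    have h := hw (φ x) (φ.map_source hx)
    rwa [φ.left_inv hx] at h
  let z : N → E := fun y => e.symm (ψ y, (e (φ x)).2)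
  have hz0 : z (f x) = φ x := by simp [z, hw']
  have hzs : ContMDiffAt 𝓘(ℝ, E') 𝓘(ℝ, E) ∞ z (f x) := by
    have h1 : ContMDiffAt 𝓘(ℝ, E') 𝓘(ℝ, E') ∞ ψ (f x) :=
      contMDiffAt_of_mem_maximalAtlas hψ hfx
    exact (e.symm.contDiff.contMDiff.contMDiffAt).comp (f x) (h1.prodMk_space contMDiffAt_const)
  have hzt : z (f x) ∈ φ.target := by rw [hz0]; exact φ.map_source hx
  refine ⟨φ.symm ∘ z, by simp [hz0, φ.left_inv hx], ?_, ?_⟩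
  · exact (contMDiffAt_symm_of_mem_maximalAtlas hφ hzt).comp (f x) hzs
  · filter_upwards [hzs.continuousAt.preimage_mem_nhds (φ.open_target.mem_nhds hzt),
      ψ.open_source.mem_nhds hfx] with y hy hy'
    apply ψ.injOn (hf.source_subset_preimage_source (φ.map_target hy)) hy'
    rw [hw _ hy]
    simp [z]

/-- A map out of the image of a surjective submersion is smooth if its composition with the
submersion is. -/
theorem ContMDiff.of_comp_isSubmersion {E₂ H₂ P : Type*} [NormedAddCommGroup E₂]
    [NormedSpace ℝ E₂] [TopologicalSpace H₂] {J : ModelWithCorners ℝ E₂ H₂} [TopologicalSpace P]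
    [ChartedSpace H₂ P] {f : M → N} {g : N → P} (hf : IsSubmersion 𝓘(ℝ, E) 𝓘(ℝ, E') ∞ f)
    (hs : Function.Surjective f) (hg : ContMDiff 𝓘(ℝ, E) J ∞ (g ∘ f)) :
    ContMDiff 𝓘(ℝ, E') J ∞ g := by
  intro y
  obtain ⟨x, rfl⟩ := hs y
  obtain ⟨s, hsx, hs, hfs⟩ := exists_localSection_of_isSubmersionAt (hf.isSubmersionAt x)
  refine ((hg.contMDiffAt (x := s (f x))).comp (f x) hs).congr_of_eventuallyEq ?_
  filter_upwards [hfs] with y hy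
  simp [hy]

theorem mfderiv_surjective_of_isSubmersionAt {f : M → N} {x : M}
    (hf : IsSubmersionAt 𝓘(ℝ, E) 𝓘(ℝ, E') ∞ f x) :
    Function.Surjective (mfderiv 𝓘(ℝ, E) 𝓘(ℝ, E') f x) := by
  obtain ⟨s, hsx, hs, hfs⟩ := exists_localSection_of_isSubmersionAt hf
  have hd : MDifferentiableAt 𝓘(ℝ, E) 𝓘(ℝ, E') f (s (f x)) := by
    rw [hsx]; exact hf.contMDiffAt.mdifferentiableAt (by simp)
  have h := mfderiv_comp (f x) hd (hs.mdifferentiableAt (by simp))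
  rw [(show f ∘ s =ᶠ[𝓝 (f x)] id from hfs).mfderiv_eq, mfderiv_id, hsx] at h
  intro v
  exact ⟨mfderiv 𝓘(ℝ, E') 𝓘(ℝ, E) s (f x) v, (congrArg (fun L => L v) h).symm⟩

theorem mfderiv_injective_of_isImmersionAt {f : M → N} {x : M}
    (hf : IsImmersionAt 𝓘(ℝ, E) 𝓘(ℝ, E') ∞ f x) :
    Function.Injective (mfderiv 𝓘(ℝ, E) 𝓘(ℝ, E') f x) := by
  set φ := hf.domChart
  set ψ := hf.codChart
  set e := hf.equiv
  have hφ : φ ∈ IsManifold.maximalAtlas 𝓘(ℝ, E) ∞ M := hf.domChart_mem_maximalAtlas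
  have hψ : ψ ∈ IsManifold.maximalAtlas 𝓘(ℝ, E') ∞ N := hf.codChart_mem_maximalAtlas
  have hx : x ∈ φ.source := hf.mem_domChart_source
  have hfx : f x ∈ ψ.source := hf.mem_codChart_source
  have hw (y : M) (hy : y ∈ φ.source) : ψ (f y) = e (φ y, 0) := by
    have hz : φ y ∈ (φ.extend 𝓘(ℝ, E)).target := by simpa using φ.map_source hy
    have h : ψ (f (φ.symm (φ y))) = e (φ y, 0) := by simpa using! hf.writtenInCharts hz
    rwa [φ.left_inv hy] at h
  -- a smooth left inverse of `f` near `x`: in the charts, `f` is the inclusion of a factor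
  let r : N → M := fun y => φ.symm (e.symm (ψ y)).1
  have hr : ContMDiffAt 𝓘(ℝ, E') 𝓘(ℝ, E) ∞ r (f x) := by
    have h1 : ContMDiffAt 𝓘(ℝ, E') 𝓘(ℝ, E') ∞ ψ (f x) :=
      contMDiffAt_of_mem_maximalAtlas hψ hfx
    have h2 : ContMDiffAt 𝓘(ℝ, E') 𝓘(ℝ, E) ∞ (fun w => (e.symm w).1) (ψ (f x)) :=
      (contDiff_fst.comp e.symm.contDiff).contMDiff.contMDiffAt
    refine ContMDiffAt.comp (f x) (contMDiffAt_symm_of_mem_maximalAtlas hφ ?_) (h2.comp (f x) h1)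
    simpa [hw x hx] using φ.map_source hx
  have h := mfderiv_comp x (hr.mdifferentiableAt (by simp))
    (hf.contMDiffAt.mdifferentiableAt (by simp))
  have hrf : r ∘ f =ᶠ[𝓝 x] id := by
    filter_upwards [φ.open_source.mem_nhds hx] with y hy
    simp [r, hw y hy, φ.left_inv hy]
  rw [hrf.mfderiv_eq, mfderiv_id] at h
  intro v w hvw
  have hv := congrArg (fun L => L v) h
  have hw := congrArg (fun L => L w) h
  simp only [ContinuousLinearMap.comp_apply] at hv hw
  rw [hvw] at hv
  exact hv.trans hw.symm

/-- A function on a connected manifold with vanishing differential is constant. -/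
theorem eq_of_mfderiv_eq_zero [ConnectedSpace M] [IsManifold 𝓘(ℝ, E) 1 M] {f : M → ℝ}
    (hf : MDifferentiable 𝓘(ℝ, E) 𝓘(ℝ) f) (h0 : ∀ x, mfderiv 𝓘(ℝ, E) 𝓘(ℝ) f x = 0) (x y : M) :
    f x = f y := by
  refine IsLocallyConstant.apply_eq_of_isPreconnected
    ((IsLocallyConstant.iff_eventually_eq f).2 fun z => ?_) isPreconnected_univ trivial trivial
  set φ := chartAt E z
  obtain ⟨r, hr, hball⟩ := Metric.isOpen_iff.1 φ.open_target (φ z) (mem_chart_target E z)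
  have hd (w : E) (hw : w ∈ Metric.ball (φ z) r) : HasFDerivAt (f ∘ φ.symm) (0 : E →L[ℝ] ℝ) w := by
    have h1 : MDifferentiableAt 𝓘(ℝ, E) 𝓘(ℝ, E) φ.symm w :=
      mdifferentiableAt_atlas_symm (chart_mem_atlas E z) (hball hw)
    have h2 := ((hf (φ.symm w)).hasMFDerivAt.comp w h1.hasMFDerivAt).hasFDerivAt
    rw [h0] at h2
    convert! h2 using 1
  filter_upwards [φ.continuousAt (mem_chart_source E z) (Metric.ball_mem_nhds _ hr),
    φ.open_source.mem_nhds (mem_chart_source E z)] with w hw hw'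
  have := (convex_ball (φ z) r).is_const_of_fderivWithin_eq_zero (𝕜 := ℝ) (f := f ∘ φ.symm)
    (fun u hu => (hd u hu).differentiableAt.differentiableWithinAt)
    (fun u hu => by rw [fderivWithin_of_isOpen Metric.isOpen_ball hu, (hd u hu).fderiv])
    hw (Metric.mem_ball_self hr)
  simpa [φ.left_inv hw', φ.left_inv (mem_chart_source E z)] using this

end Submersion
end LeafSpace

/-! ### Slices of a subgroup -/

namespace LeafSpace

open Filter Topology Set

section InverseFunction

variable {E : Type*} [NormedAddCommGroup E] [NormedSpace ℝ E]

theorem mem_contDiffGroupoid_self_iff {B : OpenPartialHomeomorph E E} :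
    B ∈ contDiffGroupoid ∞ 𝓘(ℝ, E) ↔
      ContDiffOn ℝ ∞ B B.source ∧ ContDiffOn ℝ ∞ B.symm B.target := by
  rw [contDiffGroupoid, mem_groupoid_of_pregroupoid]
  simp [contDiffPregroupoid]

/-- The inverse function theorem, with a local inverse that is a change of coordinates. -/
theorem exists_mem_contDiffGroupoid_of_hasFDerivAt [CompleteSpace E] {A : E → E} {O : Set E}
    (hO : IsOpen O) (hA : ContDiffOn ℝ ∞ A O) {w : E} (hw : w ∈ O) {L : E ≃L[ℝ] E}
    (hL : HasFDerivAt A (L : E →L[ℝ] E) w) :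
    ∃ B ∈ contDiffGroupoid ∞ 𝓘(ℝ, E), w ∈ B.source ∧ B.source ⊆ O ∧ ⇑B = A := by
  have hAw : ContDiffAt ℝ ∞ A w := hA.contDiffAt (hO.mem_nhds hw)
  set B := hAw.toOpenPartialHomeomorph A hL (by simp) with hB
  have hBA : ⇑B = A := hAw.toOpenPartialHomeomorph_coe hL (by simp)
  -- `O'` is the open set on which the derivative is invertible, so that the inverse is smooth on
  -- all of its image.
  set O' : Set E := O ∩ fderiv ℝ A ⁻¹' range ((↑) : (E ≃L[ℝ] E) → E →L[ℝ] E)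
  have hO' : IsOpen O' := (hA.continuousOn_fderiv_of_isOpen hO (by simp)).isOpen_inter_preimage hO
    ContinuousLinearEquiv.isOpen
  have hwO' : w ∈ O' := ⟨hw, L, hL.fderiv.symm⟩
  have hsub : (B.restrOpen O' hO').source ⊆ O' := fun x hx => hx.2
  refine ⟨B.restrOpen O' hO', ?_, ⟨hAw.mem_toOpenPartialHomeomorph_source hL (by simp), hwO'⟩,
    fun x hx => (hsub hx).1, hBA⟩
  rw [mem_contDiffGroupoid_self_iff]
  constructor
  · exact (hA.mono fun x hx => (hsub hx).1).congr fun x _ => congrFun hBA x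
  · intro y hy
    obtain ⟨h1, L', hL'⟩ := hsub ((B.restrOpen O' hO').map_target hy)
    have hcd := hA.contDiffAt (hO.mem_nhds h1)
    refine ((B.restrOpen O' hO').contDiffAt_symm hy (f₀' := L') ?_ ?_).contDiffWithinAt
    · rw [hL']
      exact (hcd.differentiableAt (by simp)).hasFDerivAt.congr_of_eventuallyEq
        (.of_forall fun x => congrFun hBA x)
    · exact hcd.congr_of_eventuallyEq (.of_forall fun x => congrFun hBA x)

/-- Compositions of charts with changes of coordinates of the model space are charts. -/
theorem trans_mem_maximalAtlas {M : Type*} [TopologicalSpace M] [ChartedSpace E M]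
    {ψ : OpenPartialHomeomorph M E} {B : OpenPartialHomeomorph E E}
    (hψ : ψ ∈ IsManifold.maximalAtlas 𝓘(ℝ, E) ∞ M) (hB : B ∈ contDiffGroupoid ∞ 𝓘(ℝ, E)) :
    ψ ≫ₕ B ∈ IsManifold.maximalAtlas 𝓘(ℝ, E) ∞ M := by
  intro e he
  obtain ⟨h1, h2⟩ := hψ e he
  constructor
  · rw [OpenPartialHomeomorph.trans_symm_eq_symm_trans_symm, OpenPartialHomeomorph.trans_assoc]
    exact (contDiffGroupoid ∞ 𝓘(ℝ, E)).trans ((contDiffGroupoid ∞ 𝓘(ℝ, E)).symm hB) h1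
  · rw [← OpenPartialHomeomorph.trans_assoc]
    exact (contDiffGroupoid ∞ 𝓘(ℝ, E)).trans h2 hB

end InverseFunction

section Slice

variable {E E' F : Type*} [NormedAddCommGroup E] [NormedSpace ℝ E]
  [NormedAddCommGroup E'] [NormedSpace ℝ E'] [NormedAddCommGroup F] [NormedSpace ℝ F]
  {G : Type*} [TopologicalSpace G] [ChartedSpace E G] [Group G] [LieGroup 𝓘(ℝ, E) ∞ G]

/-- Near the identity, a Lie group is the product of a slice `σ` and an immersed subgroup `K`:
in a suitable chart, the point with coordinates `(u, y)` is `σ y * κ u`, where `κ` parametrizes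
a neighbourhood of the identity in `K`. The reason is that, in a chart in which `K` is linear, the
map `(u, y) ↦ σ y * κ u` is tangent to the identity. -/
theorem exists_sliceChart [CompleteSpace E] (K : Subgroup G) [ChartedSpace E' K]
    (hK : IsImmersionAtOfComplement F 𝓘(ℝ, E') 𝓘(ℝ, E) ∞ (Subtype.val : K → G) 1) :
    ∃ (Θ : OpenPartialHomeomorph G E) (e : (E' × F) ≃L[ℝ] E) (σ : F → G) (κ : E' → K) (a : E'),
      Θ ∈ IsManifold.maximalAtlas 𝓘(ℝ, E) ∞ G ∧ e (a, 0) ∈ Θ.target ∧ κ a = 1 ∧ σ 0 = 1 ∧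
      (∀ U ∈ 𝓝 a, κ '' U ∈ 𝓝 1) ∧
      ∀ u y, e (u, y) ∈ Θ.target → Θ.symm (e (u, y)) = σ y * κ u := by
  set φ := hK.domChart
  set ψ := hK.codChart
  set e := hK.equiv
  have hφ : φ ∈ IsManifold.maximalAtlas 𝓘(ℝ, E') ∞ K := hK.domChart_mem_maximalAtlas
  have hψ : ψ ∈ IsManifold.maximalAtlas 𝓘(ℝ, E) ∞ G := hK.codChart_mem_maximalAtlas
  have hx : 1 ∈ φ.source := hK.mem_domChart_source
  have hfx : 1 ∈ ψ.source := hK.mem_codChart_source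
  have hmap (u : E') (hu : u ∈ φ.target) : ψ (φ.symm u : K) = e (u, 0) := by
    have hu' : u ∈ (φ.extend 𝓘(ℝ, E')).target := by simpa using hu
    simpa using! hK.writtenInCharts hu'
  have hsrc (u : E') (hu : u ∈ φ.target) : ((φ.symm u : K) : G) ∈ ψ.source :=
    hK.source_subset_preimage_source (φ.map_target hu)
  set a := φ 1
  have ha : a ∈ φ.target := φ.map_source hx
  have hκa : φ.symm a = 1 := φ.left_inv hx
  have hψ1 : ψ 1 = e (a, 0) := by
    have h := hmap a ha
    rwa [hκa] at h
  set σ : F → G := fun y => ψ.symm (e (a, y))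
  have hσ0 : σ 0 = 1 := by simp only [σ, ← hψ1, ψ.left_inv hfx]
  -- in the chart `ψ` and the coordinates `(u, y)`, the map `(u, y) ↦ σ y * κ u`
  set P : E → G := fun w => σ (e.symm w).2 * (φ.symm (e.symm w).1 : K)
  set O₁ : Set E := {w | e (a, (e.symm w).2) ∈ ψ.target} ∩ {w | (e.symm w).1 ∈ φ.target}
  have hO₁ : IsOpen O₁ := by
    refine (ψ.open_target.preimage ?_).inter (φ.open_target.preimage ?_) <;> fun_prop
  have hPs : ContMDiffOn 𝓘(ℝ, E) 𝓘(ℝ, E) ∞ P O₁ := by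
    have h1 : ContMDiff 𝓘(ℝ, E) 𝓘(ℝ, E) ∞ fun w => e (a, (e.symm w).2) := by
      rw [contMDiff_iff_contDiff]; fun_prop
    have h2 : ContMDiff 𝓘(ℝ, E) 𝓘(ℝ, E') ∞ fun w => (e.symm w).1 := by
      rw [contMDiff_iff_contDiff]; fun_prop
    refine ContMDiffOn.mul ?_ ?_
    · exact (contMDiffOn_symm_of_mem_maximalAtlas hψ).comp h1.contMDiffOn fun w hw => hw.1
    · exact hK.contMDiffOn.comp ((contMDiffOn_symm_of_mem_maximalAtlas hφ).comp h2.contMDiffOn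
        fun w hw => hw.2) fun w hw => φ.map_target hw.2
  set O : Set E := O₁ ∩ P ⁻¹' ψ.source
  have hO : IsOpen O := hPs.continuousOn.isOpen_inter_preimage hO₁ ψ.open_source
  have hAs : ContDiffOn ℝ ∞ (ψ ∘ P) O := by
    rw [← contMDiffOn_iff_contDiffOn]
    exact (contMDiffOn_of_mem_maximalAtlas hψ).comp (hPs.mono inter_subset_left) fun w hw => hw.2
  have hPa : P (e (a, 0)) = 1 := by simp [P, hσ0, hκa]
  have hwO : e (a, 0) ∈ O := by
    refine ⟨⟨?_, by simpa using ha⟩, by simpa [hPa] using hfx⟩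
    simpa [hψ1] using ψ.map_source hfx
  have hAd : HasFDerivAt (ψ ∘ P) ((ContinuousLinearEquiv.refl ℝ E : E ≃L[ℝ] E) : E →L[ℝ] E)
      (e (a, 0)) := by
    have hd := ((hAs.contDiffAt (hO.mem_nhds hwO)).differentiableAt (by simp)).hasFDerivAt
    set D := fderiv ℝ (ψ ∘ P) (e (a, 0))
    have he (z : E' × F) : HasFDerivAt e (e : E' × F →L[ℝ] E) z := e.hasFDerivAt
    have hinl : HasFDerivAt (fun u : E' => e (u, (0 : F)))
        ((e : E' × F →L[ℝ] E) ∘L .inl ℝ E' F) a :=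
      (he (a, 0)).comp a (hasFDerivAt_prodMk_left a 0)
    have hinr : HasFDerivAt (fun y : F => e (a, y))
        ((e : E' × F →L[ℝ] E) ∘L .inr ℝ E' F) 0 :=
      (he (a, 0)).comp (0 : F) (hasFDerivAt_prodMk_right a 0)
    -- `P` is the inverse of the chart `ψ` on each of the axes `y = 0` and `u = a`.
    have h1 : D ∘L ((e : E' × F →L[ℝ] E) ∘L .inl ℝ E' F) =
        (e : E' × F →L[ℝ] E) ∘L .inl ℝ E' F := by
      refine (hd.comp a hinl).unique (hinl.congr_of_eventuallyEq ?_)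
      filter_upwards [φ.open_target.mem_nhds ha] with u hu
      simp [P, hσ0, hmap u hu]
    have h2 : D ∘L ((e : E' × F →L[ℝ] E) ∘L .inr ℝ E' F) =
        (e : E' × F →L[ℝ] E) ∘L .inr ℝ E' F := by
      refine (hd.comp 0 hinr).unique (hinr.congr_of_eventuallyEq ?_)
      have hc : ContinuousAt (fun y : F => e (a, y)) 0 := by fun_prop
      filter_upwards [hc.preimage_mem_nhds
        (ψ.open_target.mem_nhds (by simpa [hψ1] using ψ.map_source hfx))] with y hy
      simp [P, hκa, σ, ψ.right_inv hy]
    convert! hd using 1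
    ext w
    obtain ⟨⟨u, y⟩, rfl⟩ := e.surjective w
    have h1u := congrArg (fun L => L u) h1
    have h2y := congrArg (fun L => L y) h2
    simp only [ContinuousLinearMap.comp_apply, ContinuousLinearMap.inl_apply,
      ContinuousLinearMap.inr_apply, ContinuousLinearEquiv.coe_coe] at h1u h2y
    have hsplit : ((u, y) : E' × F) = (u, 0) + (0, y) := by simp
    rw [hsplit, map_add, map_add, map_add, h1u, h2y]
    rfl
  obtain ⟨B, hB, hwB, hBO, hBA⟩ := exists_mem_contDiffGroupoid_of_hasFDerivAt hO hAs hwO hAd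
  refine ⟨ψ ≫ₕ B.symm, e, σ, φ.symm, a,
    trans_mem_maximalAtlas hψ ((contDiffGroupoid ∞ 𝓘(ℝ, E)).symm hB), ?_, hκa, hσ0, ?_, ?_⟩
  · refine ⟨by simpa using hwB, ?_⟩
    simpa [hBA, hPa] using ψ.map_source hfx
  · intro U hU
    have := φ.symm.image_mem_nhds (x := a) (by simpa using ha) hU
    rwa [hκa] at this
  · intro u y huy
    have h1 : e (u, y) ∈ B.source := by simpa using huy.1
    have h2 : P (e (u, y)) ∈ ψ.source := (hBO h1).2
    simp only [OpenPartialHomeomorph.trans_symm_eq_symm_trans_symm,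
      OpenPartialHomeomorph.symm_symm, OpenPartialHomeomorph.coe_trans, Function.comp_apply, hBA,
      ψ.left_inv h2]
    simp [P]

end Slice
end LeafSpace

/-! ### Charts of the quotient -/

namespace LeafSpace

open Filter Topology Set

section QuotientChart

variable {E E' F : Type*} [NormedAddCommGroup E] [NormedSpace ℝ E]
  [NormedAddCommGroup E'] [NormedSpace ℝ E'] [NormedAddCommGroup F] [NormedSpace ℝ F]
  {G : Type*} [TopologicalSpace G] [ChartedSpace E G] [Group G] [LieGroup 𝓘(ℝ, E) ∞ G]

variable (E E' F) in
/-- Charts of `G ⧸ K` adapted to the projection from `G`: the projection is smooth when read in the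
chart, the inverse of the chart lifts smoothly to `G`, and near the identity of `G` the projection
is linear in suitable coordinates. -/
structure IsAdaptedQuotientChart (K : Subgroup G) (c : OpenPartialHomeomorph (G ⧸ K) F) :
    Prop where
  one_mem_source : ((1 : G) : G ⧸ K) ∈ c.source
  contMDiffOn_comp_mk :
    ContMDiffOn 𝓘(ℝ, E) 𝓘(ℝ, F) ∞ (fun x : G => c (x : G ⧸ K)) ((↑) ⁻¹' c.source)
  exists_lift : ∃ σ : F → G, ContMDiffOn 𝓘(ℝ, F) 𝓘(ℝ, E) ∞ σ c.target ∧
    ∀ y ∈ c.target, c.symm y = (σ y : G ⧸ K)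
  exists_linear : ∃ Θ ∈ IsManifold.maximalAtlas 𝓘(ℝ, E) ∞ G, (1 : G) ∈ Θ.source ∧
    ∃ e : E ≃L[ℝ] F × E', ∀ z ∈ Θ.target,
      (Θ.symm z : G ⧸ K) ∈ c.source ∧ c (Θ.symm z : G ⧸ K) = (e z).1

/-- The slice of `exists_sliceChart`, projected to `G ⧸ K`, is injective near the identity, and its
inverse is an adapted chart. -/
theorem exists_isAdaptedQuotientChart [CompleteSpace E] (K : Subgroup G) [ChartedSpace E' K]
    (hK : IsImmersionAtOfComplement F 𝓘(ℝ, E') 𝓘(ℝ, E) ∞ (Subtype.val : K → G) 1) :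
    ∃ c : OpenPartialHomeomorph (G ⧸ K) F, IsAdaptedQuotientChart E E' F K c := by
  have : IsTopologicalGroup G := topologicalGroup_of_lieGroup 𝓘(ℝ, E) ∞
  obtain ⟨Θ, e, σ, κ, a, hΘ, ha, hκa, hσ0, hκ, hprod⟩ := exists_sliceChart K hK
  have hT : (fun z => e z) ⁻¹' Θ.target ∈ 𝓝 ((a, 0) : E' × F) :=
    e.continuous.continuousAt.preimage_mem_nhds (Θ.open_target.mem_nhds ha)
  obtain ⟨U, W₀, hU, haU, hW₀, h0W₀, hUW₀⟩ := mem_nhds_prod_iff'.1 hT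
  have hσ (y : F) (hy : y ∈ W₀) : σ y = Θ.symm (e (a, y)) := by
    rw [hprod a y (hUW₀ ⟨haU, hy⟩), hκa]; simp
  have hσs : ContMDiffOn 𝓘(ℝ, F) 𝓘(ℝ, E) ∞ σ W₀ := by
    have h1 : ContMDiff 𝓘(ℝ, F) 𝓘(ℝ, E) ∞ fun y : F => e (a, y) := by
      rw [contMDiff_iff_contDiff]; fun_prop
    exact ((contMDiffOn_symm_of_mem_maximalAtlas hΘ).comp h1.contMDiffOn
      fun y hy => hUW₀ ⟨haU, hy⟩).congr hσ
  -- Two points of the slice that are close to each other and lie in the same coset differ by an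
  -- element of `K` close to the identity, hence by some `κ u` with `u` in the coordinate domain.
  obtain ⟨O, hO, hOκ⟩ := mem_nhds_induced (Subtype.val : K → G) 1 _ |>.1 (hκ U (hU.mem_nhds haU))
  have hquot : ContinuousAt (fun z : F × F => (σ z.2)⁻¹ * σ z.1) (0, 0) := by
    have h0 : ContinuousAt σ 0 := hσs.continuousOn.continuousAt (hW₀.mem_nhds h0W₀)
    exact (ContinuousAt.comp' (f := Prod.snd) h0 continuousAt_snd).inv.mul
      (ContinuousAt.comp' (f := Prod.fst) h0 continuousAt_fst)
  obtain ⟨V₁, V₂, hV₁, h0V₁, hV₂, h0V₂, hV⟩ := mem_nhds_prod_iff'.1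
    (hquot.preimage_mem_nhds (by simpa [hσ0] using! hO))
  set W : Set F := W₀ ∩ (V₁ ∩ V₂)
  have hW : IsOpen W := hW₀.inter (hV₁.inter hV₂)
  have h0W : (0 : F) ∈ W := ⟨h0W₀, h0V₁, h0V₂⟩
  have hinj : InjOn (fun y => (σ y : G ⧸ K)) W := by
    intro y hy y' hy' h
    have hmem : (σ y')⁻¹ * σ y ∈ K := QuotientGroup.eq.1 h.symm
    obtain ⟨u, hu, huk⟩ := hOκ (show (⟨_, hmem⟩ : K) ∈ Subtype.val ⁻¹' O from
      hV (show (y, y') ∈ V₁ ×ˢ V₂ from ⟨hy.2.1, hy'.2.2⟩))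
    have h1 : Θ.symm (e (u, y')) = Θ.symm (e (a, y)) := by
      rw [hprod u y' (hUW₀ ⟨hu, hy'.1⟩), ← hσ y hy.1, huk]; simp
    have h2 := e.injective (Θ.symm.injOn (hUW₀ ⟨hu, hy'.1⟩) (hUW₀ ⟨haU, hy.1⟩) h1)
    exact (Prod.mk.inj h2).2.symm
  -- The image of an open part `V` of the slice is also the image of the open set `U × V`; hence it
  -- is open, as the projection is an open map.
  have himage (V : Set F) (hVW : V ⊆ W) : (fun y => (σ y : G ⧸ K)) '' V =
      (fun x : G => (x : G ⧸ K)) '' (Θ.symm '' ((fun z => e z) '' (U ×ˢ V))) := by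
    ext q
    constructor
    · rintro ⟨y, hy, rfl⟩
      exact ⟨_, ⟨_, ⟨(a, y), ⟨haU, hy⟩, rfl⟩, rfl⟩, by simp only [hσ y (hVW hy).1]⟩
    · rintro ⟨_, ⟨_, ⟨⟨u, y⟩, ⟨hu, hy⟩, rfl⟩, rfl⟩, rfl⟩
      refine ⟨y, hy, ?_⟩
      simp only [hprod u y (hUW₀ ⟨hu, (hVW hy).1⟩)]
      exact (QuotientGroup.mk_mul_of_mem _ (κ u).2).symm
  have hopen (V : Set F) (hV : IsOpen V) (hVW : V ⊆ W) :
      IsOpen ((fun y => (σ y : G ⧸ K)) '' V) := by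
    rw [himage V hVW]
    refine QuotientGroup.isOpenMap_coe _ (Θ.symm.isOpen_image_of_subset_source
      (e.toHomeomorph.isOpenMap _ (hU.prod hV)) ?_)
    rintro _ ⟨⟨u, y⟩, ⟨hu, hy⟩, rfl⟩
    exact hUW₀ ⟨hu, (hVW hy).1⟩
  have hmap : IsOpenMap (W.domRestrict fun y => (σ y : G ⧸ K)) := by
    intro V hV
    rw [domRestrict_eq, image_comp]
    exact hopen _ (hW.isOpenMap_subtype_val _ hV) (by rintro _ ⟨y, -, rfl⟩; exact y.2)
  set q : OpenPartialHomeomorph F (G ⧸ K) :=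
    OpenPartialHomeomorph.ofContinuousOpenRestrict (hinj.toPartialEquiv _ _)
      (QuotientGroup.continuous_mk.comp_continuousOn
        (hσs.continuousOn.mono fun y hy => hy.1))
      hmap hW
  have hqs : q.source = W := rfl
  have hqt : q.target = (fun y => (σ y : G ⧸ K)) '' W := rfl
  have hqa (y : F) : q y = (σ y : G ⧸ K) := rfl
  have hqy (y : F) (hy : y ∈ W) (x : G) (hx : (x : G ⧸ K) = σ y) : q.symm x = y := by
    rw [hx, ← hqa, q.left_inv hy]
  have hcoord (u : E') (hu : u ∈ U) (y : F) (hy : y ∈ W) :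
      ((Θ.symm (e (u, y)) : G) : G ⧸ K) = σ y := by
    rw [hprod u y (hUW₀ ⟨hu, hy.1⟩)]
    exact QuotientGroup.mk_mul_of_mem _ (κ u).2
  refine ⟨q.symm, ?_, ?_, ⟨σ, hσs.mono fun y hy => hy.1, fun y _ => rfl⟩, ?_⟩
  · exact ⟨0, h0W, by simp [hσ0]⟩
  · rintro x₀ ⟨y₀, hy₀, hx₀⟩
    -- Right translation by `k⁻¹` preserves cosets and moves `x₀` to the slice, where the
    -- coordinates `(u, y)` are available.
    set k : G := (σ y₀)⁻¹ * x₀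
    have hk : k ∈ K := QuotientGroup.eq.1 hx₀
    have hmk : ContMDiff 𝓘(ℝ, E) 𝓘(ℝ, E) ∞ fun x : G => x * k⁻¹ := contMDiff_mul_right
    have hxk : x₀ * k⁻¹ = Θ.symm (e (a, y₀)) := by simp [k, ← hσ y₀ hy₀.1]
    have hΘx : x₀ * k⁻¹ ∈ Θ.source := by
      rw [hxk]; exact Θ.map_target (hUW₀ ⟨haU, hy₀.1⟩)
    have hΘs : ContMDiffAt 𝓘(ℝ, E) 𝓘(ℝ, E) ∞ (fun x : G => Θ (x * k⁻¹)) x₀ :=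
      (contMDiffAt_of_mem_maximalAtlas hΘ hΘx).comp x₀ hmk.contMDiffAt
    have hΘ₀ : Θ (x₀ * k⁻¹) = e (a, y₀) := by
      rw [hxk, Θ.right_inv (hUW₀ ⟨haU, hy₀.1⟩)]
    have hsnd : ContMDiff 𝓘(ℝ, E) 𝓘(ℝ, F) ∞ fun w => (e.symm w).2 := by
      rw [contMDiff_iff_contDiff]; fun_prop
    refine ContMDiffAt.contMDiffWithinAt (ContMDiffAt.congr_of_eventuallyEq
      (hsnd.contMDiffAt.comp x₀ hΘs) ?_)
    have hnhds : (fun w => e.symm w) ⁻¹' (U ×ˢ W) ∈ 𝓝 (Θ (x₀ * k⁻¹)) :=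
      e.symm.continuous.continuousAt.preimage_mem_nhds (by
        rw [hΘ₀, e.symm_apply_apply]; exact (hU.prod hW).mem_nhds ⟨haU, hy₀⟩)
    filter_upwards [hΘs.continuousAt.preimage_mem_nhds hnhds,
      hmk.continuous.continuousAt.preimage_mem_nhds (Θ.open_source.mem_nhds hΘx)] with x hx hx'
    refine hqy _ hx.2 x ?_
    rw [← hcoord _ hx.1 _ hx.2, Prod.mk.eta, e.apply_symm_apply, Θ.left_inv hx']
    exact (QuotientGroup.mk_mul_of_mem _ (K.inv_mem hk)).symm
  · set S : Set E := (fun w => e.symm w) ⁻¹' (U ×ˢ W)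
    have hS : IsOpen S := (hU.prod hW).preimage e.symm.continuous
    refine ⟨Θ ≫ₕ .ofSet S hS, trans_mem_maximalAtlas hΘ (ofSet_mem_contDiffGroupoid hS), ?_,
      e.symm.trans (.prodComm ℝ E' F), ?_⟩
    · have h1 : Θ.symm (e (a, 0)) = 1 := by rw [← hσ 0 h0W₀, hσ0]
      refine ⟨by rw [← h1]; exact Θ.map_target ha, ?_⟩
      rw [← h1]
      simpa [S, Θ.right_inv ha] using ⟨haU, h0W⟩
    · intro z hz
      have hzS : z ∈ S := by simpa using hz.1
      have h := hcoord _ hzS.1 _ hzS.2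
      rw [Prod.mk.eta, e.apply_symm_apply] at h
      exact ⟨⟨_, hzS.2, h.symm⟩, hqy _ hzS.2 _ h⟩

end QuotientChart
end LeafSpace

/-! ### The smooth structure of the leaf space -/

namespace LeafSpace

open Filter Topology Set

section QuotientManifold

variable {E E' F : Type*} [NormedAddCommGroup E] [NormedSpace ℝ E]
  [NormedAddCommGroup E'] [NormedSpace ℝ E'] [NormedAddCommGroup F] [NormedSpace ℝ F]
  {G : Type*} [TopologicalSpace G] [ChartedSpace E G] [Group G] [LieGroup 𝓘(ℝ, E) ∞ G]

section Translate

variable [IsTopologicalGroup G] {K : Subgroup G}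

/-- The chart `q ↦ c (a⁻¹ • q)` of `G ⧸ K`. -/
noncomputable def translateChart (c : OpenPartialHomeomorph (G ⧸ K) F) (a : G) :
    OpenPartialHomeomorph (G ⧸ K) F :=
  (Homeomorph.smul (α := G ⧸ K) a⁻¹).transOpenPartialHomeomorph c

omit [NormedSpace ℝ F] in
theorem translateChart_apply (c : OpenPartialHomeomorph (G ⧸ K) F) (a x : G) :
    translateChart c a (x : G ⧸ K) = c ((a⁻¹ * x : G) : G ⧸ K) := rfl

omit [NormedSpace ℝ F] in
theorem mem_translateChart_source {c : OpenPartialHomeomorph (G ⧸ K) F} {a x : G} :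
    (x : G ⧸ K) ∈ (translateChart c a).source ↔ ((a⁻¹ * x : G) : G ⧸ K) ∈ c.source := Iff.rfl

omit [NormedSpace ℝ F] in
theorem translateChart_symm (c : OpenPartialHomeomorph (G ⧸ K) F) (a : G) (y : F) :
    (translateChart c a).symm y = a • c.symm y := by
  change (Homeomorph.smul (α := G ⧸ K) a⁻¹).symm (c.symm y) = _
  rw [Homeomorph.smul_symm_apply, inv_inv]

/-- The atlas of `G ⧸ K` consisting of the translates of a chart around the coset of `1`. -/
@[reducible]
noncomputable def quotientChartedSpace (c : OpenPartialHomeomorph (G ⧸ K) F)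
    (hc : ((1 : G) : G ⧸ K) ∈ c.source) : ChartedSpace F (G ⧸ K) where
  atlas := range fun a : G => translateChart c a
  chartAt q := translateChart c q.out
  mem_chart_source q := by
    have h : ((q.out : G) : G ⧸ K) ∈ (translateChart c q.out).source := by
      rw [mem_translateChart_source, inv_mul_cancel]
      exact hc
    rwa [show ((q.out : G) : G ⧸ K) = q from QuotientGroup.out_eq' q] at h
  chart_mem_atlas q := ⟨q.out, rfl⟩

/-- The change of coordinates from the translate by `a` to the translate by `b` is the lift `σ`,
followed by the translation by `b⁻¹ * a` in `G` and the projection; hence it is smooth. -/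
theorem isManifold_quotientChartedSpace {c : OpenPartialHomeomorph (G ⧸ K) F}
    (hc : IsAdaptedQuotientChart E E' F K c) :
    letI := quotientChartedSpace c hc.one_mem_source
    IsManifold 𝓘(ℝ, F) ∞ (G ⧸ K) := by
  let := quotientChartedSpace c hc.one_mem_source
  obtain ⟨σ, hσ, hcσ⟩ := hc.exists_lift
  apply isManifold_of_contDiffOn
  rintro _ _ ⟨a, rfl⟩ ⟨b, rfl⟩
  have hval (y : F) (hy : y ∈ c.target) : (translateChart c a).symm y =
      ((a * σ y : G) : G ⧸ K) := by
    rw [translateChart_symm, hcσ y hy]; rfl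
  have hmul : ContMDiff 𝓘(ℝ, E) 𝓘(ℝ, E) ∞ fun x : G => b⁻¹ * (a * x) :=
    contMDiff_mul_left.comp contMDiff_mul_left
  have key := hc.contMDiffOn_comp_mk.comp (s := c.target ∩
      (fun y => b⁻¹ * (a * σ y)) ⁻¹' ((fun x : G => (x : G ⧸ K)) ⁻¹' c.source))
    (hmul.comp_contMDiffOn (hσ.mono inter_subset_left)) fun y hy => hy.2
  rw [contMDiffOn_iff_contDiffOn] at key
  have hmem {y : F} (hy : y ∈ 𝓘(ℝ, F).symm ⁻¹'
      ((translateChart c a).symm ≫ₕ translateChart c b).source ∩ range 𝓘(ℝ, F)) :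
      y ∈ c.target ∩ (fun y => b⁻¹ * (a * σ y)) ⁻¹' ((fun x : G => (x : G ⧸ K)) ⁻¹' c.source) := by
    have h1 : y ∈ c.target := by
      have := hy.1.1
      simpa [translateChart] using! this
    have h2 : (translateChart c a).symm y ∈ (translateChart c b).source := hy.1.2
    rw [hval y h1, mem_translateChart_source] at h2
    exact ⟨h1, h2⟩
  refine (key.mono fun y hy => hmem hy).congr fun y hy => ?_
  change translateChart c b ((translateChart c a).symm y) = _
  rw [hval y (hmem hy).1, translateChart_apply]
  rfl

/-- The projection is linear in a translate by `p` of the coordinates of `G` at the identity, and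
hence a submersion at `p`. -/
theorem isSubmersion_mk_quotientChartedSpace {c : OpenPartialHomeomorph (G ⧸ K) F}
    (hc : IsAdaptedQuotientChart E E' F K c) :
    letI := quotientChartedSpace c hc.one_mem_source
    IsSubmersion 𝓘(ℝ, E) 𝓘(ℝ, F) ∞ ((↑) : G → G ⧸ K) := by
  let := quotientChartedSpace c hc.one_mem_source
  have := isManifold_quotientChartedSpace hc
  obtain ⟨Θ, hΘ, h1, e, he⟩ := hc.exists_linear
  refine IsSubmersionOfComplement.isSubmersion (F := E') fun p => ?_
  have hp : translateChart c p ∈ IsManifold.maximalAtlas 𝓘(ℝ, F) ∞ (G ⧸ K) :=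
    IsManifold.subset_maximalAtlas ⟨p, rfl⟩
  set Θp : OpenPartialHomeomorph G E := (Homeomorph.mulLeft p⁻¹).transOpenPartialHomeomorph Θ
  have hsymm (z : E) : Θp.symm z = p * Θ.symm z := by
    change p⁻¹⁻¹ * Θ.symm z = _
    rw [inv_inv]
  have hΘp : Θp ∈ IsManifold.maximalAtlas 𝓘(ℝ, E) ∞ G := by
    refine OpenPartialHomeomorph.mem_maximalAtlas_of_contMDiffOn Θp ?_ ?_
    · exact (contMDiffOn_of_mem_maximalAtlas hΘ).comp
        (contMDiff_mul_left (a := p⁻¹)).contMDiffOn fun x hx => hx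
    · exact ((contMDiff_mul_left (a := p)).comp_contMDiffOn
        (contMDiffOn_symm_of_mem_maximalAtlas hΘ)).congr fun z _ => hsymm z
  have hp1 : p ∈ Θp.source := by
    change p⁻¹ * p ∈ Θ.source
    simpa using h1
  have hsrc : Θp.source ⊆ (↑) ⁻¹' (translateChart c p).source := by
    intro x hx
    have hx' : p⁻¹ * x ∈ Θ.source := hx
    have := (he _ (Θ.map_source hx')).1
    rw [Θ.left_inv hx'] at this
    exact this
  refine .mk_of_charts e Θp (translateChart c p) hp1 (hsrc hp1) hΘp hp hsrc ?_
  intro z hz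
  have hz' : z ∈ Θ.target := by
    have : z ∈ Θp.target := by simpa using hz
    simpa [Θp] using! this
  have := (he z hz').2
  simp only [OpenPartialHomeomorph.extend_coe, OpenPartialHomeomorph.extend_coe_symm,
    Function.comp_apply, modelWithCornersSelf_coe, modelWithCornersSelf_coe_symm, id_eq]
  rw [hsymm, translateChart_apply, inv_mul_cancel_left, this]

end Translate

/-- The quotient of a Lie group by a Lie subgroup with the subspace topology is a manifold, and the
projection is a submersion. -/
theorem exists_chartedSpace_quotient [CompleteSpace E] (K : Subgroup G) [ChartedSpace E' K]
    (hK : IsImmersionAtOfComplement F 𝓘(ℝ, E') 𝓘(ℝ, E) ∞ (Subtype.val : K → G) 1) :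
    ∃ _ : ChartedSpace F (G ⧸ K), IsManifold 𝓘(ℝ, F) ∞ (G ⧸ K) ∧
      IsSubmersion 𝓘(ℝ, E) 𝓘(ℝ, F) ∞ ((↑) : G → G ⧸ K) := by
  have : IsTopologicalGroup G := topologicalGroup_of_lieGroup 𝓘(ℝ, E) ∞
  obtain ⟨c, hc⟩ := exists_isAdaptedQuotientChart K hK
  exact ⟨quotientChartedSpace c hc.one_mem_source, isManifold_quotientChartedSpace hc,
    isSubmersion_mk_quotientChartedSpace hc⟩

/-- A smooth structure for which the surjection `f` is a submersion contains the charts of any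
other one for which `f` is a submersion: the identity is smooth in both directions. -/
theorem maximalAtlas_subset_of_isSubmersion {M L : Type*} [TopologicalSpace M] [ChartedSpace E M]
    [TopologicalSpace L] {f : M → L} (hs : Function.Surjective f) (cs cs' : ChartedSpace F L)
    (hm : @IsManifold ℝ _ F _ _ F _ 𝓘(ℝ, F) ∞ L _ cs)
    (hm' : @IsManifold ℝ _ F _ _ F _ 𝓘(ℝ, F) ∞ L _ cs')
    (hf : @IsSubmersion ℝ F E F E _ _ _ _ _ _ _ 𝓘(ℝ, E) 𝓘(ℝ, F) M L _ _ _ cs ∞ f)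
    (hf' : @IsSubmersion ℝ F E F E _ _ _ _ _ _ _ 𝓘(ℝ, E) 𝓘(ℝ, F) M L _ _ _ cs' ∞ f) :
    @IsManifold.maximalAtlas ℝ _ F _ _ F _ 𝓘(ℝ, F) ∞ L _ cs ⊆
      @IsManifold.maximalAtlas ℝ _ F _ _ F _ 𝓘(ℝ, F) ∞ L _ cs' := by
  have h1 : @ContMDiff ℝ _ F _ _ F _ 𝓘(ℝ, F) L _ cs F _ _ F _ 𝓘(ℝ, F) L _ cs' ∞ id :=
    @ContMDiff.of_comp_isSubmersion E F _ _ _ _ M L _ _ _ cs F F L _ _ _ 𝓘(ℝ, F) _ cs' f id hf hs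
      (@IsSubmersion.contMDiff _ _ _ _ _ _ _ _ _ _ _ _ _ _ _ _ _ _ _ cs' _ _ hf')
  have h2 : @ContMDiff ℝ _ F _ _ F _ 𝓘(ℝ, F) L _ cs' F _ _ F _ 𝓘(ℝ, F) L _ cs ∞ id :=
    @ContMDiff.of_comp_isSubmersion E F _ _ _ _ M L _ _ _ cs' F F L _ _ _ 𝓘(ℝ, F) _ cs f id hf' hs
      (@IsSubmersion.contMDiff _ _ _ _ _ _ _ _ _ _ _ _ _ _ _ _ _ _ _ cs _ _ hf)
  intro φ hφ
  rw [@IsManifold.mem_maximalAtlas_iff_contMDiffOn ℝ _ F _ _ F _ 𝓘(ℝ, F) L _ cs ∞ hm φ] at hφ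
  rw [@IsManifold.mem_maximalAtlas_iff_contMDiffOn ℝ _ F _ _ F _ 𝓘(ℝ, F) L _ cs' ∞ hm' φ]
  refine ⟨@ContMDiffOn.comp ℝ _ F _ _ F _ 𝓘(ℝ, F) L _ F _ _ F _ 𝓘(ℝ, F) L _ F _ _ F _ 𝓘(ℝ, F) F _
      cs' cs _ id φ.source ∞ φ.source φ hφ.1 ?_ fun x hx => hx,
    @ContMDiff.comp_contMDiffOn ℝ _ F _ _ F _ 𝓘(ℝ, F) F _ F _ _ F _ 𝓘(ℝ, F) L _ F _ _ F _
      𝓘(ℝ, F) L _ _ cs cs' ∞ φ.symm id φ.target h1 hφ.2⟩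
  exact @ContMDiff.contMDiffOn ℝ _ F _ _ F _ 𝓘(ℝ, F) L _ cs' F _ _ F _ 𝓘(ℝ, F) L _ cs _ _ _ h2

/-- Two smooth structures for which the same surjection is a submersion coincide. -/
theorem maximalAtlas_eq_of_isSubmersion {M L : Type*} [TopologicalSpace M] [ChartedSpace E M]
    [TopologicalSpace L] {f : M → L} (hs : Function.Surjective f) (cs cs' : ChartedSpace F L)
    (hm : @IsManifold ℝ _ F _ _ F _ 𝓘(ℝ, F) ∞ L _ cs)
    (hm' : @IsManifold ℝ _ F _ _ F _ 𝓘(ℝ, F) ∞ L _ cs')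
    (hf : @IsSubmersion ℝ F E F E _ _ _ _ _ _ _ 𝓘(ℝ, E) 𝓘(ℝ, F) M L _ _ _ cs ∞ f)
    (hf' : @IsSubmersion ℝ F E F E _ _ _ _ _ _ _ 𝓘(ℝ, E) 𝓘(ℝ, F) M L _ _ _ cs' ∞ f) :
    @IsManifold.maximalAtlas ℝ _ F _ _ F _ 𝓘(ℝ, F) ∞ L _ cs =
      @IsManifold.maximalAtlas ℝ _ F _ _ F _ 𝓘(ℝ, F) ∞ L _ cs' :=
  (maximalAtlas_subset_of_isSubmersion hs cs cs' hm hm' hf hf').antisymm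
    (maximalAtlas_subset_of_isSubmersion hs cs' cs hm' hm hf' hf)

end QuotientManifold

/-- There is a smooth structure on the leaf space for which the projection is a submersion. -/
theorem exists_isLeafSpaceStructure {n : ℕ} {G : Type*} [TopologicalSpace G]
    [ChartedSpace (Eucl (n + 2)) G] [Group G] [LieGroup (𝓡 (n + 2)) ∞ G]
    (K : Subgroup G) [ChartedSpace (Eucl n) K]
    (hK : IsSmoothEmbedding (𝓡 n) (𝓡 (n + 2)) ∞ (Subtype.val : K → G)) :
    ∃ cs : ChartedSpace (Eucl 2) (G ⧸ K), IsLeafSpaceStructure (n := n + 2) K cs := by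
  have h := hK.isImmersion.isImmersionAt 1
  -- The complement of the tangent space of `K` in a slice chart has dimension two.
  have e := h.equiv.toLinearEquiv
  have : FiniteDimensional ℝ h.complement :=
    FiniteDimensional.of_injective (e.toLinearMap ∘ₗ LinearMap.inr ℝ (Eucl n) h.complement)
      (e.injective.comp LinearMap.inr_injective)
  have hd : Module.finrank ℝ h.complement = Module.finrank ℝ (Eucl 2) := by
    have := e.finrank_eq
    rw [Module.finrank_prod, finrank_euclideanSpace_fin, finrank_euclideanSpace_fin] at this
    rw [finrank_euclideanSpace_fin]
    omega
  obtain ⟨cs, hm, hs⟩ := exists_chartedSpace_quotient K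
    (h.isImmersionAtOfComplement_complement.trans_F (ContinuousLinearEquiv.ofFinrankEq hd))
  exact ⟨cs, hm, hs⟩

theorem IsLeafSpaceStructure.sameSmoothStructure {n : ℕ} {G : Type*} [TopologicalSpace G]
    [ChartedSpace (Eucl (n + 2)) G] [Group G] {K : Subgroup G}
    {cs cs' : ChartedSpace (Eucl 2) (G ⧸ K)} (h : IsLeafSpaceStructure (n := n + 2) K cs)
    (h' : IsLeafSpaceStructure (n := n + 2) K cs') : SameSmoothStructure cs cs' :=
  maximalAtlas_eq_of_isSubmersion QuotientGroup.mk_surjective cs cs' h.isManifold h'.isManifold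
    h.submersion h'.submersion

end LeafSpace

/-! ### Left-invariant vector fields -/

namespace LeafSpace

open VectorField Filter Topology

section InvariantFields

variable {E : Type*} [NormedAddCommGroup E] [NormedSpace ℝ E]
  {H : Type*} [TopologicalSpace H] {I : ModelWithCorners ℝ E H}
  {G : Type*} [TopologicalSpace G] [ChartedSpace H G] [Group G] [LieGroup I ∞ G]

/-- Left-invariant vector fields are smooth: they are obtained by composing the differential of
the multiplication with the field `p ↦ (0, v)` along `p ↦ (p, 1)`. -/
theorem contMDiff_mulInvariantVectorField_infty (v : GroupLieAlgebra I G) :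
    ContMDiff I I.tangent ∞
      (fun p => (⟨p, mulInvariantVectorField v p⟩ : TangentBundle I G)) := by
  let F₁ : G → (TangentBundle I G × TangentBundle I G) :=
    fun p ↦ (TotalSpace.mk' E p 0, TotalSpace.mk' E 1 v)
  have S₁ : ContMDiff I (I.tangent.prod I.tangent) ∞ F₁ :=
    (contMDiff_zeroSection _ _).prodMk contMDiff_const
  let F₂ : (TangentBundle I G × TangentBundle I G) → TangentBundle (I.prod I) (G × G) :=
    (equivTangentBundleProd I G I G).symm
  have S₂ : ContMDiff (I.tangent.prod I.tangent) (I.prod I).tangent ∞ F₂ :=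
    contMDiff_equivTangentBundleProd_symm
  let F₃ : TangentBundle (I.prod I) (G × G) → TangentBundle I G :=
    tangentMap (I.prod I) I (fun (p : G × G) ↦ p.1 * p.2)
  have S₃ : ContMDiff (I.prod I).tangent I.tangent ∞ F₃ :=
    ContMDiff.contMDiff_tangentMap (contMDiff_mul I ∞) (m := ∞) (by simp)
  let S := (S₃.comp S₂).comp S₁
  convert! S with p
  · simp [F₁, F₂, F₃]
  · simp only [Function.comp_apply, tangentMap, F₃, F₂, F₁]
    rw [mfderiv_prod_eq_add_apply ((contMDiff_mul I ∞).mdifferentiableAt (by simp))]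
    simp +instances only [mulInvariantVectorField]
    have key (L L' : E →L[ℝ] E) (w : E) : L' w = L 0 + L' w := by simp
    exact key _ _ v

/-- Left-invariant vector fields are invariant under left translations. -/
theorem mfderiv_mul_left_mulInvariantVectorField (v : GroupLieAlgebra I G) (a b : G) :
    mfderiv I I (fun x => a * x) b (mulInvariantVectorField v b) =
      mulInvariantVectorField v (a * b) := by
  have hd (c d : G) : MDifferentiableAt I I (fun x => c * x) d :=
    (contMDiff_mul_left (I := I) (n := ∞)).mdifferentiableAt (by simp)
  have h := mfderiv_comp_apply_of_eq 1 (hd a b) (hd b 1) (mul_one b) v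
  rw [show (fun x => a * x) ∘ (fun x => b * x) = fun x => a * b * x from
    funext fun x => (mul_assoc a b x).symm] at h
  exact h.symm

/-- The left-invariant field of a vector on a Lie subgroup is related by the inclusion to that of
the image of the vector. -/
theorem mfderiv_subtype_val_mulInvariantVectorField
    {E' : Type*} [NormedAddCommGroup E'] [NormedSpace ℝ E']
    {H' : Type*} [TopologicalSpace H'] {J : ModelWithCorners ℝ E' H'}
    {K : Subgroup G} [ChartedSpace H' K] [LieGroup J ∞ K]
    (hK : ContMDiff J I ∞ (Subtype.val : K → G)) (v : GroupLieAlgebra J K) (k : K) :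
    mfderiv J I (Subtype.val : K → G) k (mulInvariantVectorField v k) =
      mulInvariantVectorField (I := I) (mfderiv J I (Subtype.val : K → G) 1 v) (k : G) := by
  have hd (c d : G) : MDifferentiableAt I I (fun x => c * x) d :=
    (contMDiff_mul_left (I := I) (n := ∞)).mdifferentiableAt (by simp)
  have hd' (c d : K) : MDifferentiableAt J J (fun x => c * x) d :=
    (contMDiff_mul_left (I := J) (n := ∞)).mdifferentiableAt (by simp)
  have hv (c : K) := hK.mdifferentiable (by simp) c
  have h1 := mfderiv_comp_apply_of_eq 1 (hv k) (hd' k 1) (mul_one k) v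
  have h2 := mfderiv_comp_apply_of_eq 1 (hd k 1) (hv 1) rfl v
  exact h1.symm.trans h2

end InvariantFields
end LeafSpace

/-! ### Perfect Lie algebras and orthonormal pairs -/

namespace LeafSpace

open VectorField Filter Topology

section LieAlgebra

/-- Semisimple Lie algebras are perfect. -/
theorem span_lie_eq_top_of_isSemisimple (R L : Type*) [CommRing R] [LieRing L] [LieAlgebra R L]
    [LieAlgebra.IsSemisimple R L] :
    Submodule.span R {z : L | ∃ x y : L, ⁅x, y⁆ = z} = ⊤ := by
  have h : ⁅(⊤ : LieIdeal R L), (⊤ : LieIdeal R L)⁆ = ⊤ := by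
    refine top_le_iff.1 (LieAlgebra.IsSemisimple.sSup_atoms_eq_top.symm.le.trans ?_)
    refine sSup_le fun I hI => ?_
    have h1 : ⁅I, I⁆ = I := lie_eq_self_of_isAtom_of_nonabelian I hI
      (LieAlgebra.IsSemisimple.non_abelian_of_isAtom I hI)
    exact h1.symm.le.trans (LieSubmodule.mono_lie le_top le_top)
  have h2 := congrArg (fun I : LieIdeal R L => I.toSubmodule) h
  simp only [LieSubmodule.lieIdeal_oper_eq_linear_span'] at h2
  simpa using! h2

variable {𝔤 : Type*} [LieRing 𝔤] [LieAlgebra ℝ 𝔤]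

/-- If a perfect subalgebra `𝔨` acts modulo `𝔨` on the plane spanned by `A` and `C` by conformal
matrices, then it acts trivially, because these matrices commute. -/
theorem lie_mem_of_conformal_action {𝔨 : Submodule ℝ 𝔤}
    (hk : ∀ U ∈ 𝔨, ∀ U' ∈ 𝔨, ⁅U, U'⁆ ∈ 𝔨)
    (hperf : 𝔨 ≤ Submodule.span ℝ {Z | ∃ U ∈ 𝔨, ∃ U' ∈ 𝔨, ⁅U, U'⁆ = Z})
    {A C : 𝔤} {l m : 𝔤 → ℝ}
    (hA : ∀ U ∈ 𝔨, ⁅U, A⁆ - (l U • A + m U • C) ∈ 𝔨)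
    (hC : ∀ U ∈ 𝔨, ⁅U, C⁆ - (l U • C - m U • A) ∈ 𝔨) {U : 𝔤} (hU : U ∈ 𝔨) :
    ⁅U, A⁆ ∈ 𝔨 ∧ ⁅U, C⁆ ∈ 𝔨 := by
  let S : Submodule ℝ 𝔤 :=
    { carrier := {U | ⁅U, A⁆ ∈ 𝔨 ∧ ⁅U, C⁆ ∈ 𝔨}
      add_mem' := fun {a b} ha hb => by
        simp only [Set.mem_ofPred_eq, add_lie] at *
        exact ⟨add_mem ha.1 hb.1, add_mem ha.2 hb.2⟩
      zero_mem' := by simp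
      smul_mem' := fun c a ha => by
        simp only [Set.mem_ofPred_eq, smul_lie] at *
        exact ⟨𝔨.smul_mem c ha.1, 𝔨.smul_mem c ha.2⟩ }
  -- It suffices to treat brackets `[V, W]`. By the Jacobi identity these act on the plane, modulo
  -- `𝔨`, as commutators of conformal matrices, hence by zero; the elements of `𝔨` given below are
  -- the remainders.
  suffices h : Submodule.span ℝ {Z | ∃ U ∈ 𝔨, ∃ U' ∈ 𝔨, ⁅U, U'⁆ = Z} ≤ S from h (hperf hU)
  rw [Submodule.span_le]
  rintro _ ⟨V, hV, W, hW, rfl⟩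
  have mem {a b : 𝔤} (hb : b ∈ 𝔨) (h : a = b) : a ∈ 𝔨 := h ▸ hb
  have hVA := hA V hV
  have hWA := hA W hW
  have hVC := hC V hV
  have hWC := hC W hW
  constructor
  · refine mem (b := l W • (⁅V, A⁆ - (l V • A + m V • C)) + m W • (⁅V, C⁆ - (l V • C - m V • A)) +
      ⁅V, ⁅W, A⁆ - (l W • A + m W • C)⁆ - l V • (⁅W, A⁆ - (l W • A + m W • C)) -
      m V • (⁅W, C⁆ - (l W • C - m W • A)) - ⁅W, ⁅V, A⁆ - (l V • A + m V • C)⁆) ?_ ?_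
    · exact sub_mem (sub_mem (sub_mem (add_mem (add_mem (𝔨.smul_mem _ hVA) (𝔨.smul_mem _ hVC))
        (hk _ hV _ hWA)) (𝔨.smul_mem _ hWA)) (𝔨.smul_mem _ hWC)) (hk _ hW _ hVA)
    · simp only [lie_lie, lie_sub, lie_add, lie_smul]
      module
  · refine mem (b := l W • (⁅V, C⁆ - (l V • C - m V • A)) - m W • (⁅V, A⁆ - (l V • A + m V • C)) +
      ⁅V, ⁅W, C⁆ - (l W • C - m W • A)⁆ - l V • (⁅W, C⁆ - (l W • C - m W • A)) +
      m V • (⁅W, A⁆ - (l W • A + m W • C)) - ⁅W, ⁅V, C⁆ - (l V • C - m V • A)⁆) ?_ ?_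
    · exact sub_mem (add_mem (sub_mem (add_mem (sub_mem (𝔨.smul_mem _ hVC) (𝔨.smul_mem _ hVA))
        (hk _ hV _ hWC)) (𝔨.smul_mem _ hWC)) (𝔨.smul_mem _ hWA)) (hk _ hW _ hVC)
    · simp only [lie_lie, lie_sub, lie_smul]
      module

end LieAlgebra

section Orthonormal

variable {V : Type*} [AddCommGroup V] [Module ℝ V] [FiniteDimensional ℝ V]

/-- If `X, Y` is an orthonormal pair in the orthogonal complement of a subspace `W` of codimension
two, then a vector minus its projection to the plane of `X, Y` lies in `W`. -/
theorem mem_of_orthonormal_pair (B : V →ₗ[ℝ] V →ₗ[ℝ] ℝ) (hB : ∀ v w, B v w = B w v)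
    {W : Submodule ℝ V} (hW : Module.finrank ℝ V = Module.finrank ℝ W + 2) {X Y : V}
    (hX : ∀ w ∈ W, B X w = 0) (hY : ∀ w ∈ W, B Y w = 0) (hXX : B X X = 1) (hYY : B Y Y = 1)
    (hXY : B X Y = 0) (v : V) : v - (B v X • X + B v Y • Y) ∈ W := by
  let φ : V →ₗ[ℝ] ℝ × ℝ := (B X).prod (B Y)
  have hφ : LinearMap.range φ = ⊤ := by
    rw [LinearMap.range_eq_top]
    rintro ⟨a, b⟩
    exact ⟨a • X + b • Y, by simp [φ, hXX, hYY, hXY, hB Y X]⟩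
  have hle : W ≤ LinearMap.ker φ := fun w hw => by simp [φ, hX w hw, hY w hw]
  have hr := φ.finrank_range_add_finrank_ker
  rw [hφ, finrank_top, Module.finrank_prod, Module.finrank_self] at hr
  rw [Submodule.eq_of_le_of_finrank_eq hle (by omega)]
  simp [φ, hXX, hYY, hXY, hB Y X, hB v]

theorem exists_norm_one_orthogonal (B : V →ₗ[ℝ] V →ₗ[ℝ] ℝ) (hB : ∀ v, v ≠ 0 → 0 < B v v)
    {W : Submodule ℝ V} (hW : Module.finrank ℝ W < Module.finrank ℝ V) :
    ∃ X : V, B X X = 1 ∧ ∀ w ∈ W, B X w = 0 := by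
  -- The orthogonal complement of `W` is the kernel of a map to the dual of `W`.
  let φ : V →ₗ[ℝ] Module.Dual ℝ W := LinearMap.domRestrict₁₂ B ⊤ W ∘ₗ
    (LinearMap.id.codRestrict ⊤ fun _ => trivial)
  have h := φ.finrank_range_add_finrank_ker
  have h1 : Module.finrank ℝ (LinearMap.range φ) ≤ Module.finrank ℝ W := by
    rw [← Subspace.dual_finrank_eq (V := W)]
    exact Submodule.finrank_le _
  have : 0 < Module.finrank ℝ (LinearMap.ker φ) := by omega
  have := Module.finrank_pos_iff.1 this
  obtain ⟨⟨x, hx⟩, hx0⟩ := exists_ne (0 : LinearMap.ker φ)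
  have hx0' : x ≠ 0 := fun h => hx0 (Subtype.ext h)
  have hp := hB x hx0'
  refine ⟨(Real.sqrt (B x x))⁻¹ • x, ?_, fun w hw => ?_⟩
  · have := Real.mul_self_sqrt hp.le
    have h2 := (Real.sqrt_pos.2 hp).ne'
    simp only [map_smul, LinearMap.smul_apply, smul_eq_mul]
    field_simp
    rw [sq, this]
  · have : φ x ⟨w, hw⟩ = 0 := by rw [hx]; rfl
    have h3 : B x w = 0 := this
    simp [h3]

theorem exists_orthonormal_pair (B : V →ₗ[ℝ] V →ₗ[ℝ] ℝ) (hB : ∀ v, v ≠ 0 → 0 < B v v)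
    {W : Submodule ℝ V} (hW : Module.finrank ℝ V = Module.finrank ℝ W + 2) :
    ∃ X Y : V, (∀ w ∈ W, B X w = 0) ∧ (∀ w ∈ W, B Y w = 0) ∧ B X X = 1 ∧ B Y Y = 1 ∧
      B Y X = 0 := by
  obtain ⟨X, hX1, hX⟩ := exists_norm_one_orthogonal B hB (W := W) (by omega)
  have h1 : Module.finrank ℝ ↥(W ⊔ ℝ ∙ X) ≤ Module.finrank ℝ W + 1 :=
    (Submodule.finrank_add_le_finrank_add_finrank _ _).trans
      (by gcongr; simpa using finrank_span_le_card ({X} : Set V))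
  obtain ⟨Y, hY1, hY⟩ := exists_norm_one_orthogonal B hB (W := W ⊔ ℝ ∙ X) (by omega)
  exact ⟨X, Y, hX, fun w hw => hY w (le_sup_left (a := W) hw), hX1, hY1,
    hY X (le_sup_right (a := W) (Submodule.mem_span_singleton_self X))⟩

end Orthonormal
end LeafSpace

/-! ### The Lie algebra of a conformal foliation -/

namespace LeafSpace

open VectorField Filter Topology

section Horizontal

variable {d n : ℕ} {G : Type*} [TopologicalSpace G] [ChartedSpace (Eucl d) G] [Group G]

omit [Group G] in
/-- All tangent spaces are the model space, so that equal points may be exchanged without transport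
of the vectors. -/
theorem inner_eq_inner_of_eq [IsManifold (𝓡 d) ∞ G] (g : Metric d G) {p q : G} (h : p = q)
    (v w : Eucl d) : g.inner p v w = g.inner q v w := by
  subst h; rfl

variable [LieGroup (𝓡 d) ∞ G]

/-- The scalar product of two left-invariant fields is constant. -/
theorem IsLeftInvariant.inner_mulInvariantVectorField {g : Metric d G} (hg : IsLeftInvariant g)
    (v w : GroupLieAlgebra (𝓡 d) G) (p : G) :
    g.inner p (mulInvariantVectorField v p) (mulInvariantVectorField w p) = g.inner 1 v w :=
  (inner_eq_inner_of_eq g (mul_one p).symm _ _).trans (hg p 1 v w)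

omit [LieGroup (𝓡 d) ∞ G] in
theorem mulInvariantVectorField_one (v : GroupLieAlgebra (𝓡 d) G) :
    mulInvariantVectorField v (1 : G) = v := by
  have h : (fun x : G => 1 * x) = id := funext one_mul
  change mfderiv (𝓡 d) (𝓡 d) (fun x : G => 1 * x) 1 v = v
  rw [h, mfderiv_id]
  rfl

/-- Every tangent vector is the value of a left-invariant field. -/
theorem exists_mulInvariantVectorField_eq (p : G) (w : TangentSpace (𝓡 d) p) :
    ∃ v : GroupLieAlgebra (𝓡 d) G, mulInvariantVectorField v p = w := by
  have hd (c e : G) : MDifferentiableAt (𝓡 d) (𝓡 d) (fun x => c * x) e :=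
    (contMDiff_mul_left (I := 𝓡 d) (n := ∞)).mdifferentiableAt (by simp)
  have h := mfderiv_comp_apply_of_eq p (hd p 1) (hd p⁻¹ p) (inv_mul_cancel p) w
  refine ⟨mfderiv (𝓡 d) (𝓡 d) (fun x => p⁻¹ * x) p w, h.symm.trans ?_⟩
  rw [show (fun x => p * x) ∘ (fun x => p⁻¹ * x) = id from funext (mul_inv_cancel_left p),
    mfderiv_id]
  rfl

variable {K : Subgroup G} [ChartedSpace (Eucl n) K]

omit [LieGroup (𝓡 d) ∞ G] in
theorem mem_leafDistribution {p : G} {v : GroupLieAlgebra (𝓡 d) G} (hv : v ∈ lieAlgebraOf n K) :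
    mulInvariantVectorField v p ∈ leafDistribution n K p := ⟨v, hv, rfl⟩

omit [LieGroup (𝓡 d) ∞ G] in
theorem leafDistribution_one : leafDistribution (n := d) n K 1 = lieAlgebraOf n K := by
  ext w
  constructor
  · rintro ⟨v, hv, rfl⟩
    rwa [mulInvariantVectorField_one]
  · intro hw
    exact ⟨w, hw, mulInvariantVectorField_one w⟩

/-- Left-invariant fields that are horizontal at the identity are horizontal. -/
theorem mulInvariantVectorField_mem_orthogonal {g : Metric d G} (hg : IsLeftInvariant g)
    {v : GroupLieAlgebra (𝓡 d) G} (hv : v ∈ orthogonal g 1 (leafDistribution n K 1)) (p : G) :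
    mulInvariantVectorField v p ∈ orthogonal g p (leafDistribution n K p) := by
  rintro _ ⟨u, hu, rfl⟩
  rw [hg.inner_mulInvariantVectorField]
  exact hv u (by rwa [leafDistribution_one])

/-- The conformality of the foliation, expressed in the Lie algebra: by the Koszul formula,
`g(∇_X Y + ∇_Y X, U)` is given by brackets. The form `l` is twice the scalar product with `V₀`. -/
theorem IsConformal.inner_lie_add_inner_lie {g : Metric d G} (hg : IsLeftInvariant g)
    (hF : IsConformal g (leafDistribution n K)) :
    ∃ l : GroupLieAlgebra (𝓡 d) G → ℝ, ∀ U ∈ lieAlgebraOf n K,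
      ∀ X ∈ orthogonal g 1 (leafDistribution n K 1),
      ∀ Y ∈ orthogonal g 1 (leafDistribution n K 1),
        g.inner 1 Y ⁅U, X⁆ + g.inner 1 X ⁅U, Y⁆ = g.inner 1 X Y * l U := by
  obtain ⟨nabla, hLC, V₀, -, -, hV⟩ := hF
  refine ⟨fun U => 2 * g.inner 1 (V₀ 1) U, fun U hU X hX Y hY => ?_⟩
  have hs (v : GroupLieAlgebra (𝓡 d) G) :
      SmoothFieldOn (mulInvariantVectorField v) (Set.univ : Set G) :=
    (contMDiff_mulInvariantVectorField_infty v).contMDiffOn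
  have hd (v : GroupLieAlgebra (𝓡 d) G) (p : G) :
      FieldDifferentiableAt (mulInvariantVectorField v) p :=
    (contMDiff_mulInvariantVectorField_infty v).mdifferentiable (by simp) p
  have h1 := (hV _ _ (hs X) (hs Y) (mulInvariantVectorField_mem_orthogonal hg hX)
    (mulInvariantVectorField_mem_orthogonal hg hY) 1).2 U (by rwa [leafDistribution_one])
  have hm (v w u : GroupLieAlgebra (𝓡 d) G) :
      0 = g.inner 1 (nabla (mulInvariantVectorField v) 1 u) w +
        g.inner 1 v (nabla (mulInvariantVectorField w) 1 u) := by
    have h := hLC.metric (mulInvariantVectorField u) _ _ 1 (hd v 1) (hd w 1)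
    simp only [hg.inner_mulInvariantVectorField, mulInvariantVectorField_one] at h
    rw [← h]
    simp [mvfderiv]
  have ht (v w : GroupLieAlgebra (𝓡 d) G) :
      nabla (mulInvariantVectorField w) 1 v - nabla (mulInvariantVectorField v) 1 w = ⁅v, w⁆ := by
    have h := (CovariantDerivative.torsion_eq_zero_iff nabla).1 hLC.torsion_free (hd v 1) (hd w 1)
    simp only [mulInvariantVectorField_one] at h
    exact h
  have e1 := hm X Y U
  have e2 := hm Y U X
  have e3 := hm X U Y
  rw [← ht U X, ← ht U Y]
  simp only [map_sub, map_add, map_smul, sub_apply,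
    add_apply, smul_apply, smul_eq_mul,
    mulInvariantVectorField_one] at h1 ⊢
  rw [g.symm 1 _ Y] at e1
  linarith

variable (d n K) in
/-- The differential at the identity of the inclusion of a Lie subgroup, as a map between the Lie
algebras; its range is `lieAlgebraOf n K`. -/
noncomputable def inclusionDifferential : GroupLieAlgebra (𝓡 n) K →ₗ[ℝ] GroupLieAlgebra (𝓡 d) G :=
  (mfderiv (𝓡 n) (𝓡 d) (Subtype.val : K → G) 1).toLinearMap

/-- The differential of the inclusion is a morphism of Lie algebras. -/
theorem inclusionDifferential_lie [LieGroup (𝓡 n) ∞ K]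
    (hK : ContMDiff (𝓡 n) (𝓡 d) ∞ (Subtype.val : K → G)) (u v : GroupLieAlgebra (𝓡 n) K) :
    inclusionDifferential d n K ⁅u, v⁆ =
      ⁅inclusionDifferential d n K u, inclusionDifferential d n K v⁆ :=
  mfderiv_mlieBracket_of_related (x := 1) hK
    (contMDiff_mulInvariantVectorField_infty u _) (contMDiff_mulInvariantVectorField_infty v _)
    (contMDiff_mulInvariantVectorField_infty _ _) (contMDiff_mulInvariantVectorField_infty _ _)
    (mfderiv_subtype_val_mulInvariantVectorField hK u)
    (mfderiv_subtype_val_mulInvariantVectorField hK v)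

theorem lie_mem_lieAlgebraOf [LieGroup (𝓡 n) ∞ K]
    (hK : ContMDiff (𝓡 n) (𝓡 d) ∞ (Subtype.val : K → G)) {U V : GroupLieAlgebra (𝓡 d) G}
    (hU : U ∈ lieAlgebraOf n K) (hV : V ∈ lieAlgebraOf n K) : ⁅U, V⁆ ∈ lieAlgebraOf n K := by
  obtain ⟨u, rfl⟩ := hU
  obtain ⟨v, rfl⟩ := hV
  exact ⟨⁅u, v⁆, inclusionDifferential_lie hK u v⟩

/-- The Lie algebra of a semisimple subgroup is spanned by its brackets. -/
theorem lieAlgebraOf_le_span_lie [LieGroup (𝓡 n) ∞ K]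
    (hK : ContMDiff (𝓡 n) (𝓡 d) ∞ (Subtype.val : K → G))
    (hKs : LieAlgebra.IsSemisimple ℝ (GroupLieAlgebra (𝓡 n) K)) :
    (lieAlgebraOf n K : Submodule ℝ (GroupLieAlgebra (𝓡 d) G)) ≤
      Submodule.span ℝ {Z | ∃ U ∈ (lieAlgebraOf n K : Submodule ℝ (GroupLieAlgebra (𝓡 d) G)),
        ∃ U' ∈ (lieAlgebraOf n K : Submodule ℝ (GroupLieAlgebra (𝓡 d) G)), ⁅U, U'⁆ = Z} := by
  rintro _ ⟨u, rfl⟩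
  have hu : u ∈ Submodule.span ℝ {z : GroupLieAlgebra (𝓡 n) K | ∃ x y : GroupLieAlgebra (𝓡 n) K,
      ⁅x, y⁆ = z} := by
    rw [span_lie_eq_top_of_isSemisimple]
    trivial
  induction hu using Submodule.span_induction with
  | mem x hx =>
    obtain ⟨y, z, rfl⟩ := hx
    exact Submodule.subset_span ⟨_, ⟨y, rfl⟩, _, ⟨z, rfl⟩, (inclusionDifferential_lie hK y z).symm⟩
  | zero => exact (map_zero (inclusionDifferential d n K)).symm ▸ zero_mem _
  | add x y _ _ hx hy => exact (map_add (inclusionDifferential d n K) x y).symm ▸ add_mem hx hy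
  | smul a x _ hx =>
    exact (map_smul (inclusionDifferential d n K) a x).symm ▸ Submodule.smul_mem _ a hx

omit [LieGroup (𝓡 d) ∞ G] in
theorem finrank_lieAlgebraOf (hK : IsImmersion (𝓡 n) (𝓡 d) ∞ (Subtype.val : K → G)) :
    Module.finrank ℝ (lieAlgebraOf n K : Submodule ℝ (GroupLieAlgebra (𝓡 d) G)) = n := by
  have h := LinearMap.finrank_range_of_inj (f := inclusionDifferential d n K)
    (mfderiv_injective_of_isImmersionAt (hK.isImmersionAt 1))
  exact h.trans finrank_euclideanSpace_fin

/-- The scalar product on the Lie algebra, as a bilinear form. -/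
noncomputable def innerBilin (g : Metric d G) :
    GroupLieAlgebra (𝓡 d) G →ₗ[ℝ] GroupLieAlgebra (𝓡 d) G →ₗ[ℝ] ℝ :=
  LinearMap.mk₂ ℝ (fun v w => g.inner 1 v w) (by simp) (by simp) (by simp) (by simp)

end Horizontal

section Codimension

variable {n : ℕ} {G : Type*} [TopologicalSpace G] [ChartedSpace (Eucl (n + 2)) G] [Group G]
  [LieGroup (𝓡 (n + 2)) ∞ G] {K : Subgroup G} [ChartedSpace (Eucl n) K]

omit [LieGroup (𝓡 (n + 2)) ∞ G] in
theorem finrank_eq_finrank_lieAlgebraOf_add_two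
    (hK : IsImmersion (𝓡 n) (𝓡 (n + 2)) ∞ (Subtype.val : K → G)) :
    Module.finrank ℝ (GroupLieAlgebra (𝓡 (n + 2)) G) =
      Module.finrank ℝ (lieAlgebraOf n K : Submodule ℝ (GroupLieAlgebra (𝓡 (n + 2)) G)) + 2 := by
  rw [finrank_lieAlgebraOf hK]
  exact finrank_euclideanSpace_fin

/-- `X, Y` is an orthonormal basis of the horizontal space at the identity. -/
structure IsHorizontalBasis (g : Metric (n + 2) G) (K : Subgroup G) [ChartedSpace (Eucl n) K]
    (X Y : GroupLieAlgebra (𝓡 (n + 2)) G) : Prop where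
  horizontal_left : X ∈ orthogonal g 1 (leafDistribution n K 1)
  horizontal_right : Y ∈ orthogonal g 1 (leafDistribution n K 1)
  norm_left : g.inner 1 X X = 1
  norm_right : g.inner 1 Y Y = 1
  inner_eq_zero : g.inner 1 X Y = 0

theorem IsAdaptedFrame.isHorizontalBasis {g : Metric (n + 2) G}
    {X Y : GroupLieAlgebra (𝓡 (n + 2)) G} {ρ : ℝ} (h : IsAdaptedFrame n g K X Y ρ) :
    IsHorizontalBasis g K X Y where
  __ := h

theorem exists_isHorizontalBasis (g : Metric (n + 2) G)
    (hK : IsImmersion (𝓡 n) (𝓡 (n + 2)) ∞ (Subtype.val : K → G)) :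
    ∃ X Y, IsHorizontalBasis g K X Y := by
  have : FiniteDimensional ℝ (GroupLieAlgebra (𝓡 (n + 2)) G) :=
    inferInstanceAs (FiniteDimensional ℝ (Eucl (n + 2)))
  obtain ⟨X, Y, hX, hY, hXX, hYY, hYX⟩ := exists_orthonormal_pair (innerBilin g)
    (fun v hv => g.pos 1 v hv) (finrank_eq_finrank_lieAlgebraOf_add_two hK)
  rw [← leafDistribution_one] at hX hY
  exact ⟨X, Y, hX, hY, hXX, hYY, (g.symm 1 X Y).trans hYX⟩

variable {g : Metric (n + 2) G} {X Y : GroupLieAlgebra (𝓡 (n + 2)) G}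

/-- A vector minus its projection to the horizontal plane is vertical. -/
theorem IsHorizontalBasis.sub_mem (h : IsHorizontalBasis g K X Y)
    (hK : IsImmersion (𝓡 n) (𝓡 (n + 2)) ∞ (Subtype.val : K → G))
    (v : GroupLieAlgebra (𝓡 (n + 2)) G) :
    v - (g.inner 1 v X • X + g.inner 1 v Y • Y) ∈ lieAlgebraOf n K := by
  have : FiniteDimensional ℝ (GroupLieAlgebra (𝓡 (n + 2)) G) :=
    inferInstanceAs (FiniteDimensional ℝ (Eucl (n + 2)))
  refine mem_of_orthonormal_pair (innerBilin g) (g.symm 1)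
    (finrank_eq_finrank_lieAlgebraOf_add_two hK) (fun w hw => h.horizontal_left w ?_)
    (fun w hw => h.horizontal_right w ?_) h.norm_left h.norm_right h.inner_eq_zero v <;>
  rwa [leafDistribution_one]

/-- For a conformal foliation by the cosets of a semisimple group, the Lie algebra of the subgroup
is an ideal. -/
theorem lie_mem_lieAlgebraOf_of_isConformal [LieGroup (𝓡 n) ∞ K] (hg : IsLeftInvariant g)
    (hF : IsConformal g (leafDistribution n K))
    (hK : IsImmersion (𝓡 n) (𝓡 (n + 2)) ∞ (Subtype.val : K → G))
    (hKs : LieAlgebra.IsSemisimple ℝ (GroupLieAlgebra (𝓡 n) K))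
    {U : GroupLieAlgebra (𝓡 (n + 2)) G} (hU : U ∈ lieAlgebraOf n K)
    (v : GroupLieAlgebra (𝓡 (n + 2)) G) : ⁅U, v⁆ ∈ lieAlgebraOf n K := by
  obtain ⟨X, Y, h⟩ := exists_isHorizontalBasis (K := K) g hK
  obtain ⟨l, hl⟩ := hF.inner_lie_add_inner_lie hg
  have hXY : ⁅U, X⁆ ∈ lieAlgebraOf n K ∧ ⁅U, Y⁆ ∈ lieAlgebraOf n K := by
    refine lie_mem_of_conformal_action (fun U hU V hV => lie_mem_lieAlgebraOf hK.contMDiff hU hV)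
      (lieAlgebraOf_le_span_lie hK.contMDiff hKs) (l := fun U => l U / 2)
      (m := fun U => g.inner 1 ⁅U, X⁆ Y) (fun U hU => ?_) (fun U hU => ?_) hU
    · have h1 := hl U hU X h.horizontal_left X h.horizontal_left
      rw [h.norm_left, g.symm 1 X] at h1
      convert h.sub_mem hK ⁅U, X⁆ using 4
      linarith
    · have h1 := hl U hU X h.horizontal_left Y h.horizontal_right
      have h2 := hl U hU Y h.horizontal_right Y h.horizontal_right
      rw [h.norm_right, g.symm 1 Y] at h2
      rw [h.inner_eq_zero, g.symm 1 X, g.symm 1 Y] at h1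
      convert h.sub_mem hK ⁅U, Y⁆ using 1
      rw [show g.inner 1 ⁅U, Y⁆ X = - g.inner 1 ⁅U, X⁆ Y by linarith,
        show g.inner 1 ⁅U, Y⁆ Y = l U / 2 by linarith]
      module
  have hv := h.sub_mem hK v
  set a := g.inner 1 v X
  set b := g.inner 1 v Y
  rw [show v = (v - (a • X + b • Y)) + (a • X + b • Y) by abel, lie_add, lie_add,
    lie_smul, lie_smul]
  exact add_mem (lie_mem_lieAlgebraOf hK.contMDiff hU hv)
    (add_mem (Submodule.smul_mem _ _ hXY.1) (Submodule.smul_mem _ _ hXY.2))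

/-- Rotating an orthonormal basis `A, B` of the horizontal space so that its first vector points in
the direction of the horizontal part of `[A, B]` gives an adapted frame. -/
theorem exists_isAdaptedFrame (g : Metric (n + 2) G)
    (hK : IsImmersion (𝓡 n) (𝓡 (n + 2)) ∞ (Subtype.val : K → G)) :
    ∃ X Y ρ, IsAdaptedFrame n g K X Y ρ := by
  obtain ⟨A, B, h⟩ := exists_isHorizontalBasis (K := K) g hK
  have hZ := h.sub_mem hK ⁅A, B⁆
  -- polar coordinates of the horizontal part of `[A, B]`; `r` may be zero
  obtain ⟨r, c, s, hcs, ha, hb⟩ : ∃ r c s : ℝ, c * c + s * s = 1 ∧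
      g.inner 1 ⁅A, B⁆ A = r * c ∧ g.inner 1 ⁅A, B⁆ B = r * s := by
    set z : ℂ := ⟨g.inner 1 ⁅A, B⁆ A, g.inner 1 ⁅A, B⁆ B⟩
    refine ⟨‖z‖, Real.cos z.arg, Real.sin z.arg, ?_, ?_, ?_⟩
    · rw [← sq, ← sq, Real.cos_sq_add_sin_sq]
    · rw [Complex.norm_mul_cos_arg]
    · rw [Complex.norm_mul_sin_arg]
  have hAB := h.inner_eq_zero
  have hBA : g.inner 1 B A = 0 := (g.symm 1 B A).trans hAB
  have hA := h.norm_left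
  have hB := h.norm_right
  have hl := add_mem (Submodule.smul_mem _ c h.horizontal_left)
    (Submodule.smul_mem _ s h.horizontal_right)
  -- rotations do not change the bracket of the pair
  have hlie : ⁅c • A + s • B, c • B - s • A⁆ = ⁅A, B⁆ := by
    simp only [lie_sub, add_lie, lie_smul, smul_lie, lie_self, smul_zero]
    rw [← lie_skew B A]
    calc _ = (c * c + s * s) • ⁅A, B⁆ := by module
      _ = ⁅A, B⁆ := by rw [hcs, one_smul]
  refine ⟨c • A + s • B, c • B - s • A, r, hl, sub_mem (Submodule.smul_mem _ c h.horizontal_right)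
    (Submodule.smul_mem _ s h.horizontal_left), ?_, ?_, ?_, Submodule.smul_mem _ r hl, ?_⟩
  · simp only [map_add, map_smul, add_apply, smul_apply, smul_eq_mul, hA, hB, hAB, hBA]
    linarith
  · simp only [map_sub, map_smul, sub_apply, smul_apply, smul_eq_mul, hA, hB, hAB, hBA]
    linarith
  · simp only [map_add, map_sub, map_smul, add_apply, smul_apply, smul_eq_mul, hA, hB,
      hAB, hBA]
    ring
  · intro w hw
    rw [g.symm]
    apply hw
    rw [leafDistribution_one, hlie]
    convert hZ using 2
    rw [ha, hb]
    module

end Codimension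
end LeafSpace

/-! ### Descent of left-invariant fields to the quotient -/

namespace LeafSpace

open VectorField Filter Topology

section Descent

variable {d n l : ℕ} {G : Type*} [TopologicalSpace G] [ChartedSpace (Eucl d) G] [Group G]
  [LieGroup (𝓡 d) ∞ G] {K : Subgroup G} [ChartedSpace (Eucl n) K] [LieGroup (𝓡 n) ∞ K]
  [ChartedSpace (Eucl l) (G ⧸ K)]

omit [LieGroup (𝓡 n) ∞ K] [ChartedSpace (Eucl l) (G ⧸ K)] in
theorem contMDiff_coset_mul (hK : ContMDiff (𝓡 n) (𝓡 d) ∞ (Subtype.val : K → G))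
    (p : G) : ContMDiff (𝓡 n) (𝓡 d) ∞ fun k : K => p * k :=
  contMDiff_mul_left.comp hK

omit [ChartedSpace (Eucl l) (G ⧸ K)] in
/-- The left-invariant field of a vector tangent to `K` is related, by the parametrization
`k ↦ p * k` of a leaf, to the field of that vector on `K`. -/
theorem mfderiv_coset_mul (hK : ContMDiff (𝓡 n) (𝓡 d) ∞ (Subtype.val : K → G))
    (p : G) (u : GroupLieAlgebra (𝓡 n) K) (k : K) :
    mfderiv (𝓡 n) (𝓡 d) (fun k : K => p * k) k (mulInvariantVectorField u k) =
      mulInvariantVectorField (inclusionDifferential d n K u) (p * k) := by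
  have hd (c e : G) : MDifferentiableAt (𝓡 d) (𝓡 d) (fun x => c * x) e :=
    (contMDiff_mul_left (I := 𝓡 d) (n := ∞)).mdifferentiableAt (by simp)
  have h := mfderiv_comp_apply_of_eq k (hd p k) (hK.mdifferentiable (by simp) k) rfl
    (mulInvariantVectorField u k)
  refine h.trans ?_
  rw [mfderiv_subtype_val_mulInvariantVectorField hK u k]
  exact mfderiv_mul_left_mulInvariantVectorField _ p k

/-- The projection kills the left-invariant fields tangent to the leaves. -/
theorem mfderiv_mk_mulInvariantVectorField_eq_zero
    (hπ : ContMDiff (𝓡 d) (𝓡 l) ∞ (QuotientGroup.mk : G → G ⧸ K))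
    (hK : ContMDiff (𝓡 n) (𝓡 d) ∞ (Subtype.val : K → G)) {U : GroupLieAlgebra (𝓡 d) G}
    (hU : U ∈ lieAlgebraOf n K) (p : G) :
    mfderiv (𝓡 d) (𝓡 l) (QuotientGroup.mk : G → G ⧸ K) p (mulInvariantVectorField U p) = 0 := by
  obtain ⟨u, rfl⟩ := hU
  -- The value at `p` is replaced by that at `p * 1`, the point of the parametrized leaf; the two
  -- are equal, but not by definition.
  suffices h : ∀ q : G, q = p * (1 : K) → mfderiv (𝓡 d) (𝓡 l) (QuotientGroup.mk : G → G ⧸ K) q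
      (mulInvariantVectorField (inclusionDifferential d n K u) q) = 0 from h p (mul_one p).symm
  rintro _ rfl
  rw [← mfderiv_coset_mul hK p u 1]
  have h := mfderiv_comp_apply 1 (hπ.mdifferentiable (by simp) _)
    ((contMDiff_coset_mul hK p).mdifferentiable (by simp) 1) (mulInvariantVectorField u 1)
  refine h.symm.trans ?_
  rw [show (QuotientGroup.mk : G → G ⧸ K) ∘ (fun k : K => p * k) = fun _ => (p : G ⧸ K) from
    funext fun k => QuotientGroup.mk_mul_of_mem p k.2, mfderiv_const]
  rfl

/-- If `[𝔨, v] ⊆ 𝔨`, the left-invariant field of `v` takes the same value in the quotient along each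
leaf. For `u` a function on the quotient and `f` its pullback, `v f` is constant along the leaf
since `U (v f) = v (U f) + [U, v] f = 0` for `U` in `𝔨`. -/
theorem mfderiv_mk_mulInvariantVectorField_congr [ConnectedSpace K] [IsManifold (𝓡 l) ∞ (G ⧸ K)]
    (hπ : ContMDiff (𝓡 d) (𝓡 l) ∞ (QuotientGroup.mk : G → G ⧸ K))
    (hK : ContMDiff (𝓡 n) (𝓡 d) ∞ (Subtype.val : K → G)) {v : GroupLieAlgebra (𝓡 d) G}
    (hv : ∀ U : GroupLieAlgebra (𝓡 d) G, U ∈ lieAlgebraOf n K → ⁅U, v⁆ ∈ lieAlgebraOf n K)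
    {p q : G} (hpq : (p : G ⧸ K) = q) :
    (mfderiv (𝓡 d) (𝓡 l) (QuotientGroup.mk : G → G ⧸ K) p (mulInvariantVectorField v p) : Eucl l) =
      mfderiv (𝓡 d) (𝓡 l) (QuotientGroup.mk : G → G ⧸ K) q (mulInvariantVectorField v q) := by
  obtain ⟨k₀, rfl⟩ : ∃ k₀ : K, q = p * k₀ :=
    ⟨⟨p⁻¹ * q, QuotientGroup.eq.1 hpq⟩, (mul_inv_cancel_left p q).symm⟩
  have hmk (k : K) : ((p * k : G) : G ⧸ K) = p := QuotientGroup.mk_mul_of_mem p k.2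
  have hπd (x : G) := hπ.mdifferentiable (by simp) x
  refine tangentVector_ext (I := 𝓡 l) (y := (p : G ⧸ K)) fun u hu => ?_
  set f : G → ℝ := u ∘ QuotientGroup.mk with hf
  have hu' (k : K) : ContMDiffAt (𝓡 l) 𝓘(ℝ) ∞ u ((p * k : G) : G ⧸ K) := by rwa [hmk]
  have hfs (k : K) : ContMDiffAt (𝓡 d) 𝓘(ℝ) ∞ f (p * k) := (hu' k).comp _ hπ.contMDiffAt
  have hinv (w : GroupLieAlgebra (𝓡 d) G) (x : G) :=
    (contMDiff_mulInvariantVectorField_infty w).contMDiffAt (x := x)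
  have hvert {U : GroupLieAlgebra (𝓡 d) G} (hU : U ∈ lieAlgebraOf n K) {x : G}
      (hx : MDifferentiableAt (𝓡 l) 𝓘(ℝ) u (x : G ⧸ K)) :
      mvfderiv (𝓡 d) f x (mulInvariantVectorField U x) = 0 := by
    rw [hf, mvfderiv_comp_apply x hx (hπd x),
      mfderiv_mk_mulInvariantVectorField_eq_zero hπ hK hU, map_zero]
  let F : G → ℝ := fun x => mvfderiv (𝓡 d) f x (mulInvariantVectorField v x)
  have hF (k : K) : MDifferentiableAt (𝓡 d) 𝓘(ℝ) F (p * k) :=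
    (contMDiffAt_mvfderiv_apply (hfs k) (by simp) (hinv v _)).mdifferentiableAt (by simp)
  have hφ (k : K) := (contMDiff_coset_mul hK p).mdifferentiable (by simp) k
  -- The function `v f` is constant along the leaf: its derivative along `U` in `𝔨` vanishes.
  have hc (k : K) : mfderiv (𝓡 n) 𝓘(ℝ) (F ∘ fun k : K => p * k) k = 0 := by
    ext w
    obtain ⟨w, rfl⟩ := exists_mulInvariantVectorField_eq k w
    have h1 := mvfderiv_comp_apply k (hF k) (hφ k) (mulInvariantVectorField w k)
    rw [mfderiv_coset_mul hK] at h1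
    set U := inclusionDifferential d n K w
    have hU : U ∈ lieAlgebraOf n K := ⟨w, rfl⟩
    have h2 := mvfderiv_mlieBracket (hinv U (p * k)) (hinv v (p * k)) (hfs k)
    rw [← mulInvariantVector_mlieBracket, ← GroupLieAlgebra.bracket_def,
      hvert (hv U hU) ((hu' k).mdifferentiableAt (by simp))] at h2
    have h3 : (fun x => mvfderiv (𝓡 d) f x (mulInvariantVectorField U x)) =ᶠ[𝓝 (p * k : G)]
        fun _ => 0 := by
      filter_upwards [(hπd (p * k)).continuousAt.eventually
        (ContMDiffAt.eventually_mdifferentiableAt (hu' k))] with x hx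
      exact hvert hU hx
    rw [mvfderiv_congr h3, mvfderiv_const] at h2
    rw [zero_apply, sub_zero] at h2
    exact h1.trans h2.symm
  -- `v f` at a point `x` of the leaf is the derivative of `u` along the projection of `v`.
  have hval (x : G) (hx : (x : G ⧸ K) = p) : F x = mvfderiv (𝓡 l) u (p : G ⧸ K)
      (mfderiv (𝓡 d) (𝓡 l) (QuotientGroup.mk : G → G ⧸ K) x (mulInvariantVectorField v x)) := by
    have key (y : G ⧸ K) (hy : y = p) (w : Eucl l) :
        mvfderiv (𝓡 l) u y w = mvfderiv (𝓡 l) u (p : G ⧸ K) w := by subst hy; rfl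
    refine Eq.trans ?_ (key _ hx _)
    exact mvfderiv_comp_apply x ((hx ▸ hu).mdifferentiableAt (by simp)) (hπd x) _
  rw [← hval p rfl, ← hval _ (hmk k₀)]
  have h := eq_of_mfderiv_eq_zero (fun k => (hF k).comp k (hφ k)) hc 1 k₀
  have h1 : F (p * (1 : K)) = F p := by rw [OneMemClass.coe_one, mul_one]
  exact h1.symm.trans h

variable (l K) in
/-- The vector field on `G ⧸ K` induced by the left-invariant field of `v`, read off at a chosen
representative of each coset. -/
noncomputable def quotientField (v : GroupLieAlgebra (𝓡 d) G) (q : G ⧸ K) :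
    TangentSpace (𝓡 l) q :=
  (mfderiv (𝓡 d) (𝓡 l) (QuotientGroup.mk : G → G ⧸ K) q.out (mulInvariantVectorField v q.out) :
    Eucl l)

/-- The left-invariant field of `v` is related to `quotientField l K v` if `[𝔨, v] ⊆ 𝔨`. -/
theorem mfderiv_mk_mulInvariantVectorField [ConnectedSpace K] [IsManifold (𝓡 l) ∞ (G ⧸ K)]
    (hπ : ContMDiff (𝓡 d) (𝓡 l) ∞ (QuotientGroup.mk : G → G ⧸ K))
    (hK : ContMDiff (𝓡 n) (𝓡 d) ∞ (Subtype.val : K → G)) {v : GroupLieAlgebra (𝓡 d) G}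
    (hv : ∀ U : GroupLieAlgebra (𝓡 d) G, U ∈ lieAlgebraOf n K → ⁅U, v⁆ ∈ lieAlgebraOf n K)
    (p : G) :
    mfderiv (𝓡 d) (𝓡 l) (QuotientGroup.mk : G → G ⧸ K) p (mulInvariantVectorField v p) =
      quotientField l K v (p : G ⧸ K) :=
  mfderiv_mk_mulInvariantVectorField_congr hπ hK hv (QuotientGroup.out_eq' _).symm

/-- The induced fields are smooth: their pullbacks along the projection are sections along it that
are images of left-invariant fields. -/
theorem contMDiff_quotientField [ConnectedSpace K] [IsManifold (𝓡 l) ∞ (G ⧸ K)]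
    (hπ : IsSubmersion (𝓡 d) (𝓡 l) ∞ (QuotientGroup.mk : G → G ⧸ K))
    (hK : ContMDiff (𝓡 n) (𝓡 d) ∞ (Subtype.val : K → G)) {v : GroupLieAlgebra (𝓡 d) G}
    (hv : ∀ U : GroupLieAlgebra (𝓡 d) G, U ∈ lieAlgebraOf n K → ⁅U, v⁆ ∈ lieAlgebraOf n K) :
    ContMDiff (𝓡 l) (𝓡 l).tangent ∞
      (fun q => (⟨q, quotientField l K v q⟩ : TangentBundle (𝓡 l) (G ⧸ K))) := by
  refine ContMDiff.of_comp_isSubmersion hπ QuotientGroup.mk_surjective fun p => ?_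
  refine (contMDiffAt_mfderiv_section hπ.contMDiff.contMDiffAt (by simp)
    (contMDiff_mulInvariantVectorField_infty v p)).congr_of_eventuallyEq (.of_forall fun x => ?_)
  simp only [Function.comp_apply]
  rw [mfderiv_mk_mulInvariantVectorField hπ.contMDiff hK hv]

/-- The induced fields are related to the left-invariant ones, hence so are their brackets. -/
theorem mlieBracket_quotientField [ConnectedSpace K] [IsManifold (𝓡 l) ∞ (G ⧸ K)]
    (hπ : IsSubmersion (𝓡 d) (𝓡 l) ∞ (QuotientGroup.mk : G → G ⧸ K))
    (hK : ContMDiff (𝓡 n) (𝓡 d) ∞ (Subtype.val : K → G)) {v w : GroupLieAlgebra (𝓡 d) G}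
    (hv : ∀ U : GroupLieAlgebra (𝓡 d) G, U ∈ lieAlgebraOf n K → ⁅U, v⁆ ∈ lieAlgebraOf n K)
    (hw : ∀ U : GroupLieAlgebra (𝓡 d) G, U ∈ lieAlgebraOf n K → ⁅U, w⁆ ∈ lieAlgebraOf n K)
    (p : G) :
    mlieBracket (𝓡 l) (quotientField l K v) (quotientField l K w) (p : G ⧸ K) =
      mfderiv (𝓡 d) (𝓡 l) (QuotientGroup.mk : G → G ⧸ K) p
        (mulInvariantVectorField ⁅v, w⁆ p) := by
  rw [GroupLieAlgebra.bracket_def, mulInvariantVector_mlieBracket]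
  exact (mfderiv_mlieBracket_of_related hπ.contMDiff
    (contMDiff_mulInvariantVectorField_infty v p) (contMDiff_mulInvariantVectorField_infty w p)
    (contMDiff_quotientField hπ hK hv _) (contMDiff_quotientField hπ hK hw _)
    (mfderiv_mk_mulInvariantVectorField hπ.contMDiff hK hv)
    (mfderiv_mk_mulInvariantVectorField hπ.contMDiff hK hw)).symm

end Descent
end LeafSpace

/-! ### Metrics defined by frames -/

namespace LeafSpace

open VectorField Filter Topology

section HomBundle

/-- A family of linear maps on a finite-dimensional space is smooth if all its values are. -/
theorem contMDiffAt_clm_of_forall_apply {EM : Type*} [NormedAddCommGroup EM] [NormedSpace ℝ EM]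
    {HM : Type*} [TopologicalSpace HM] {I : ModelWithCorners ℝ EM HM} {M : Type*}
    [TopologicalSpace M] [ChartedSpace HM M] {F F' : Type*} [NormedAddCommGroup F]
    [NormedSpace ℝ F] [FiniteDimensional ℝ F] [NormedAddCommGroup F'] [NormedSpace ℝ F']
    {k : ℕ∞ω} {Φ : M → F →L[ℝ] F'} {x : M}
    (h : ∀ v, ContMDiffAt I 𝓘(ℝ, F') k (fun y => Φ y v) x) :
    ContMDiffAt I 𝓘(ℝ, F →L[ℝ] F') k Φ x := by
  let β := Module.finBasis ℝ F
  let c := fun i => LinearMap.toContinuousLinearMap (β.coord i)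
  have h1 : Φ = fun y => ∑ i, ContinuousLinearMap.smulRightL ℝ F F' (c i) (Φ y (β i)) := by
    funext y
    ext v
    rw [sum_apply]
    conv_lhs => rw [← β.sum_repr v, map_sum]
    simp [c]
  rw [h1]
  refine contMDiffAt_finsetSum fun i _ => ?_
  exact (ContinuousLinearMap.smulRightL ℝ F F' (c i)).contMDiff.contMDiffAt.comp x (h (β i))

variable {EB : Type*} [NormedAddCommGroup EB] [NormedSpace ℝ EB] {HB : Type*}
  [TopologicalSpace HB] {IB : ModelWithCorners ℝ EB HB} {B : Type*} [TopologicalSpace B]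
  [ChartedSpace HB B] {F₁ F₂ : Type*} [NormedAddCommGroup F₁] [NormedSpace ℝ F₁]
  [FiniteDimensional ℝ F₁] [NormedAddCommGroup F₂] [NormedSpace ℝ F₂]
  {E₁ E₂ : B → Type*} [∀ x, AddCommGroup (E₁ x)] [∀ x, Module ℝ (E₁ x)]
  [TopologicalSpace (TotalSpace F₁ E₁)] [∀ x, TopologicalSpace (E₁ x)] [FiberBundle F₁ E₁]
  [VectorBundle ℝ F₁ E₁]
  [∀ x, AddCommGroup (E₂ x)] [∀ x, Module ℝ (E₂ x)]
  [TopologicalSpace (TotalSpace F₂ E₂)] [∀ x, TopologicalSpace (E₂ x)] [FiberBundle F₂ E₂]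
  [VectorBundle ℝ F₂ E₂] [∀ x, IsTopologicalAddGroup (E₂ x)] [∀ x, ContinuousSMul ℝ (E₂ x)]
  {k : ℕ∞ω}

/-- A family of linear maps between the fibres of two vector bundles is smooth if it sends smooth
local sections to smooth local sections. -/
theorem contMDiffAt_hom_bundle_of_forall {f : ∀ b, E₁ b →L[ℝ] E₂ b} {x : B}
    (h : ∀ s : ∀ b, E₁ b, ContMDiffAt IB (IB.prod 𝓘(ℝ, F₁)) k
      (fun b => TotalSpace.mk' F₁ b (s b)) x →
      ContMDiffAt IB (IB.prod 𝓘(ℝ, F₂)) k (fun b => TotalSpace.mk' F₂ b (f b (s b))) x) :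
    ContMDiffAt IB (IB.prod 𝓘(ℝ, F₁ →L[ℝ] F₂)) k
      (fun b => TotalSpace.mk' (F₁ →L[ℝ] F₂) (E := fun b => E₁ b →L[ℝ] E₂ b) b (f b)) x := by
  rw [contMDiffAt_hom_bundle]
  refine ⟨contMDiffAt_id, contMDiffAt_clm_of_forall_apply fun v => ?_⟩
  have hs := h (fun b => (trivializationAt F₁ E₁ x).symmL ℝ b v) ?_
  · rw [contMDiffAt_totalSpace] at hs
    refine hs.2.congr_of_eventuallyEq ?_
    filter_upwards [(trivializationAt F₂ E₂ x).open_baseSet.mem_nhds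
      (mem_baseSet_trivializationAt F₂ E₂ x)] with b hb
    simp only [ContinuousLinearMap.inCoordinates, ContinuousLinearMap.comp_apply]
    rw [Trivialization.continuousLinearMapAt_apply, Trivialization.linearMapAt_apply, if_pos hb]
  · rw [contMDiffAt_totalSpace]
    refine ⟨contMDiffAt_id, (contMDiffAt_const (c := v)).congr_of_eventuallyEq ?_⟩
    filter_upwards [(trivializationAt F₁ E₁ x).open_baseSet.mem_nhds
      (mem_baseSet_trivializationAt F₁ E₁ x)] with b hb
    rw [Trivialization.symmL_apply _ hb]
    exact congrArg Prod.snd ((trivializationAt F₁ E₁ x).apply_mk_symm hb v)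

end HomBundle

section FrameMetric

/-- The determinant of two vectors in the plane. -/
def planeDet (v w : Eucl 2) : ℝ := v 0 * w 1 - v 1 * w 0

/-- The coefficient of `v` in the expansion of a vector in the basis `v, w`, by Cramer's rule. It is
zero when `v, w` are linearly dependent. -/
noncomputable def planeCoord (v w : Eucl 2) : Eucl 2 →L[ℝ] ℝ :=
  (planeDet v w)⁻¹ • ((w 1) • EuclideanSpace.proj 0 - (w 0) • EuclideanSpace.proj 1)

theorem planeCoord_apply (v w z : Eucl 2) :
    planeCoord v w z = planeDet z w / planeDet v w := by
  simp [planeCoord, planeDet]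
  ring

variable {v w : Eucl 2}

theorem planeDet_swap : planeDet w v = - planeDet v w := by simp [planeDet]; ring

theorem planeCoord_self (h : planeDet v w ≠ 0) : planeCoord v w v = 1 := by
  rw [planeCoord_apply, div_self h]

theorem planeCoord_other : planeCoord v w w = 0 := by
  rw [planeCoord_apply]; simp [planeDet, mul_comm]

theorem planeCoord_smul_add (h : planeDet v w ≠ 0) (z : Eucl 2) :
    z = planeCoord v w z • v + planeCoord w v z • w := by
  rw [planeCoord_apply, planeCoord_apply, planeDet_swap (v := v) (w := w)]
  ext i
  fin_cases i <;> simp <;> field_simp <;> simp [planeDet] <;> ring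

theorem eq_zero_of_smul_add_smul_eq_zero (h : planeDet v w ≠ 0) {a b : ℝ}
    (hab : a • v + b • w = 0) :
    a = 0 ∧ b = 0 := by
  have h1 : planeDet (a • v + b • w) w = a * planeDet v w := by simp [planeDet]; ring
  have h2 : planeDet v (a • v + b • w) = b * planeDet v w := by simp [planeDet]; ring
  have h0 : planeDet 0 w = 0 := by simp [planeDet]
  have h0' : planeDet v 0 = 0 := by simp [planeDet]
  rw [hab] at h1 h2
  exact ⟨(mul_eq_zero.1 (h1.symm.trans h0)).resolve_right h,
    (mul_eq_zero.1 (h2.symm.trans h0')).resolve_right h⟩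

theorem planeDet_ne_zero_of_span (h : ∀ z : Eucl 2, ∃ a b : ℝ, z = a • v + b • w) :
    planeDet v w ≠ 0 := by
  intro h0
  obtain ⟨a, b, hx⟩ := h (EuclideanSpace.single 0 1)
  obtain ⟨c, d, hy⟩ := h (EuclideanSpace.single 1 1)
  have h1 : planeDet (EuclideanSpace.single 0 1) (EuclideanSpace.single 1 1) = 1 := by
    simp [planeDet]
  rw [hx, hy] at h1
  have : planeDet (a • v + b • w) (c • v + d • w) = (a * d - b * c) * planeDet v w := by
    simp [planeDet]; ring
  rw [this, h0, mul_zero] at h1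
  exact zero_ne_one h1

theorem planeDet_map_ne_zero (τ : Eucl 2 ≃ₗ[ℝ] Eucl 2) (h : planeDet v w ≠ 0) :
    planeDet (τ v) (τ w) ≠ 0 := by
  refine planeDet_ne_zero_of_span fun z =>
    ⟨planeCoord v w (τ.symm z), planeCoord w v (τ.symm z), ?_⟩
  rw [← map_smul, ← map_smul, ← map_add, ← planeCoord_smul_add h, τ.apply_symm_apply]

/-- Cramer's rule may be evaluated after a linear change of coordinates `τ`. -/
theorem planeCoord_eq_div_map (τ : Eucl 2 ≃ₗ[ℝ] Eucl 2) (h : planeDet v w ≠ 0) (z : Eucl 2) :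
    planeCoord v w z = planeDet (τ z) (τ w) / planeDet (τ v) (τ w) := by
  rw [eq_div_iff (planeDet_map_ne_zero τ h)]
  conv_rhs => rw [planeCoord_smul_add h z, map_add, map_smul, map_smul]
  simp [planeDet]
  ring

/-- The scalar product on the plane for which `v, w` is an orthonormal basis. -/
noncomputable def planeInner (v w : Eucl 2) : Eucl 2 →L[ℝ] Eucl 2 →L[ℝ] ℝ :=
  (planeCoord v w).smulRight (planeCoord v w) + (planeCoord w v).smulRight (planeCoord w v)

theorem planeInner_apply (v w x y : Eucl 2) : planeInner v w x y =
    planeCoord v w x * planeCoord v w y + planeCoord w v x * planeCoord w v y := rfl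

theorem planeInner_symm (v w x y : Eucl 2) : planeInner v w x y = planeInner v w y x := by
  rw [planeInner_apply, planeInner_apply]; ring

theorem planeInner_left_left (h : planeDet v w ≠ 0) : planeInner v w v v = 1 := by
  rw [planeInner_apply, planeCoord_self h, planeCoord_other]; ring

theorem planeInner_right_right (h : planeDet v w ≠ 0) : planeInner v w w w = 1 := by
  rw [planeInner_apply, planeCoord_self (by rw [planeDet_swap]; exact neg_ne_zero.2 h),
    planeCoord_other]
  ring

theorem planeInner_left_right : planeInner v w v w = 0 := by
  rw [planeInner_apply, planeCoord_other, planeCoord_other]; ring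

theorem planeInner_pos (h : planeDet v w ≠ 0) {x : Eucl 2} (hx : x ≠ 0) :
    0 < planeInner v w x x := by
  rw [planeInner_apply]
  by_contra hn
  have ha : planeCoord v w x = 0 := by nlinarith
  have hb : planeCoord w v x = 0 := by nlinarith
  apply hx
  rw [planeCoord_smul_add h x, ha, hb, zero_smul, zero_smul, add_zero]

theorem isVonNBounded_planeInner (h : planeDet v w ≠ 0) :
    Bornology.IsVonNBounded ℝ {x : Eucl 2 | planeInner v w x x < 1} := by
  rw [NormedSpace.isVonNBounded_iff]
  refine isBounded_iff_forall_norm_le.2 ⟨‖v‖ + ‖w‖, fun x hx => ?_⟩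
  have hx' : planeInner v w x x < 1 := hx
  rw [planeInner_apply] at hx'
  have ha : |planeCoord v w x| ≤ 1 := abs_le_one_iff_mul_self_le_one.2 (by nlinarith)
  have hb : |planeCoord w v x| ≤ 1 := abs_le_one_iff_mul_self_le_one.2 (by nlinarith)
  rw [planeCoord_smul_add h x]
  refine (norm_add_le _ _).trans ?_
  rw [norm_smul, norm_smul]
  exact add_le_add (mul_le_of_le_one_left (norm_nonneg _) ha)
    (mul_le_of_le_one_left (norm_nonneg _) hb)

theorem contMDiffAt_planeDet {EM : Type*} [NormedAddCommGroup EM] [NormedSpace ℝ EM]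
    {HM : Type*} [TopologicalSpace HM] {I : ModelWithCorners ℝ EM HM} {M : Type*}
    [TopologicalSpace M] [ChartedSpace HM M] {k : ℕ∞ω} {a b : M → Eucl 2} {x : M}
    (ha : ContMDiffAt I (𝓡 2) k a x) (hb : ContMDiffAt I (𝓡 2) k b x) :
    ContMDiffAt I 𝓘(ℝ) k (fun y => planeDet (a y) (b y)) x := by
  have hc (i : Fin 2) {c : M → Eucl 2} (hc : ContMDiffAt I (𝓡 2) k c x) :
      ContMDiffAt I 𝓘(ℝ) k (fun y => c y i) x :=
    (EuclideanSpace.proj i : Eucl 2 →L[ℝ] ℝ).contMDiff.contMDiffAt.comp x hc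
  exact ((hc 0 ha).mul (hc 1 hb)).sub ((hc 1 ha).mul (hc 0 hb))

variable {L : Type*} [TopologicalSpace L] [ChartedSpace (Eucl 2) L] [IsManifold (𝓡 2) ∞ L]

/-- The coefficients of a smooth vector field in a smooth frame of a surface are smooth, by
Cramer's rule in a trivialization. -/
theorem contMDiffAt_planeCoord {k : ℕ∞ω} {x : L} {e₁ e₂ s : ∀ q : L, TangentSpace (𝓡 2) q}
    (he : ∀ q, planeDet (e₁ q) (e₂ q) ≠ 0)
    (h₁ : ContMDiffAt (𝓡 2) (𝓡 2).tangent k (fun q => (⟨q, e₁ q⟩ : TangentBundle (𝓡 2) L)) x)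
    (h₂ : ContMDiffAt (𝓡 2) (𝓡 2).tangent k (fun q => (⟨q, e₂ q⟩ : TangentBundle (𝓡 2) L)) x)
    (hs : ContMDiffAt (𝓡 2) (𝓡 2).tangent k (fun q => (⟨q, s q⟩ : TangentBundle (𝓡 2) L)) x) :
    ContMDiffAt (𝓡 2) 𝓘(ℝ) k (fun q => planeCoord (e₁ q) (e₂ q) (s q)) x := by
  rw [contMDiffAt_totalSpace] at h₁ h₂ hs
  let t := trivializationAt (Eucl 2) (TangentSpace (𝓡 2) : L → Type _) x
  have ht : ∀ᶠ b in 𝓝 x, b ∈ t.baseSet :=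
    t.open_baseSet.mem_nhds (mem_baseSet_trivializationAt _ _ x)
  have key {b : L} (hb : b ∈ t.baseSet) : ∃ τ : Eucl 2 ≃ₗ[ℝ] Eucl 2,
      ∀ v : TangentSpace (𝓡 2) b, (t ⟨b, v⟩).2 = τ v :=
    ⟨t.linearEquivAt ℝ b hb, fun v => rfl⟩
  have hq : ContMDiffAt (𝓡 2) 𝓘(ℝ) k (fun b => planeDet (t ⟨b, s b⟩).2 (t ⟨b, e₂ b⟩).2 /
      planeDet (t ⟨b, e₁ b⟩).2 (t ⟨b, e₂ b⟩).2) x := by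
    refine (contMDiffAt_planeDet hs.2 h₂.2).div₀ (contMDiffAt_planeDet h₁.2 h₂.2) ?_
    obtain ⟨τ, hτ⟩ := key ht.self_of_nhds
    rw [hτ, hτ]
    exact planeDet_map_ne_zero τ (he x)
  refine hq.congr_of_eventuallyEq ?_
  filter_upwards [ht] with b hb
  obtain ⟨τ, hτ⟩ := key hb
  rw [hτ, hτ, hτ]
  exact planeCoord_eq_div_map τ (he b) (s b)

/-- Every smooth frame of a surface is orthonormal for some Riemannian metric. -/
theorem exists_metric_of_frame {e₁ e₂ : ∀ q : L, TangentSpace (𝓡 2) q}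
    (he : ∀ q, planeDet (e₁ q) (e₂ q) ≠ 0)
    (h₁ : ContMDiff (𝓡 2) (𝓡 2).tangent ∞ (fun q => (⟨q, e₁ q⟩ : TangentBundle (𝓡 2) L)))
    (h₂ : ContMDiff (𝓡 2) (𝓡 2).tangent ∞ (fun q => (⟨q, e₂ q⟩ : TangentBundle (𝓡 2) L))) :
    ∃ h : Metric 2 L, ∀ q, h.inner q (e₁ q) (e₁ q) = 1 ∧ h.inner q (e₂ q) (e₂ q) = 1 ∧
      h.inner q (e₁ q) (e₂ q) = 0 := by
  have he' (q : L) : planeDet (e₂ q) (e₁ q) ≠ 0 :=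
    (planeDet_swap (v := e₁ q) (w := e₂ q)).trans_ne (neg_ne_zero.2 (he q))
  refine ⟨⟨fun q => planeInner (e₁ q) (e₂ q), fun q => planeInner_symm (e₁ q) (e₂ q),
    fun q v hv => planeInner_pos (he q) hv, fun q => isVonNBounded_planeInner (he q), fun x => ?_⟩,
    fun q => ⟨planeInner_left_left (he q), planeInner_right_right (he q), planeInner_left_right⟩⟩
  refine contMDiffAt_hom_bundle_of_forall (E₁ := fun q : L => TangentSpace (𝓡 2) q)
    (E₂ := fun q : L => TangentSpace (𝓡 2) q →L[ℝ] Bundle.Trivial L ℝ q) fun s hs => ?_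
  refine contMDiffAt_hom_bundle_of_forall (E₁ := fun q : L => TangentSpace (𝓡 2) q)
    (E₂ := fun q : L => Bundle.Trivial L ℝ q) fun t ht => ?_
  rw [contMDiffAt_section]
  exact ((contMDiffAt_planeCoord he (h₁ x) (h₂ x) hs).mul
    (contMDiffAt_planeCoord he (h₁ x) (h₂ x) ht)).add
    ((contMDiffAt_planeCoord he' (h₂ x) (h₁ x) hs).mul
      (contMDiffAt_planeCoord he' (h₂ x) (h₁ x) ht))

end FrameMetric
end LeafSpace

/-! ### The metric of the leaf space -/

namespace LeafSpace

open VectorField Filter Topology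

section LeafSpaceMetric

variable {n : ℕ} {G : Type*} [TopologicalSpace G] [ChartedSpace (Eucl (n + 2)) G] [Group G]
  [LieGroup (𝓡 (n + 2)) ∞ G] {K : Subgroup G} [ChartedSpace (Eucl n) K] [LieGroup (𝓡 n) ∞ K]
  [ConnectedSpace K] [ChartedSpace (Eucl 2) (G ⧸ K)] [IsManifold (𝓡 2) ∞ (G ⧸ K)]
  {g : Metric (n + 2) G} {X Y : GroupLieAlgebra (𝓡 (n + 2)) G}

variable (n K) in
/-- The Lie algebra of `K` is an ideal of that of `G`. -/
def IsIdeal : Prop :=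
  ∀ v U : GroupLieAlgebra (𝓡 (n + 2)) G, U ∈ lieAlgebraOf n K → ⁅U, v⁆ ∈ lieAlgebraOf n K

/-- The projection of a left-invariant field, in terms of the fields induced by `X` and `Y`. -/
theorem IsHorizontalBasis.mfderiv_mk (h : IsHorizontalBasis g K X Y)
    (hK : IsImmersion (𝓡 n) (𝓡 (n + 2)) ∞ (Subtype.val : K → G))
    (hπ : IsSubmersion (𝓡 (n + 2)) (𝓡 2) ∞ (QuotientGroup.mk : G → G ⧸ K)) (hid : IsIdeal n K)
    (p : G) (v : GroupLieAlgebra (𝓡 (n + 2)) G) :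
    mfderiv (𝓡 (n + 2)) (𝓡 2) (QuotientGroup.mk : G → G ⧸ K) p (mulInvariantVectorField v p) =
      g.inner 1 v X • quotientField 2 K X (p : G ⧸ K) +
        g.inner 1 v Y • quotientField 2 K Y (p : G ⧸ K) := by
  set a := g.inner 1 v X
  set b := g.inner 1 v Y
  have h1 := mfderiv_mk_mulInvariantVectorField_eq_zero hπ.contMDiff hK.contMDiff
    (h.sub_mem hK v) p
  have h2 : v = (v - (a • X + b • Y)) + (a • X + b • Y) := by abel
  rw [← mfderiv_mk_mulInvariantVectorField hπ.contMDiff hK.contMDiff (hid X),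
    ← mfderiv_mk_mulInvariantVectorField hπ.contMDiff hK.contMDiff (hid Y), ← map_smul, ← map_smul,
    ← map_add]
  conv_lhs => rw [h2]
  rw [mulInvariantVectorField_add, mulInvariantVectorField_add (a • X),
    mulInvariantVectorField_smul, mulInvariantVectorField_smul]
  simp only [Pi.add_apply, Pi.smul_apply, map_add]
  rw [h1, zero_add]

/-- The fields induced by `X` and `Y` span, because the projection is a submersion. -/
theorem IsHorizontalBasis.planeDet_ne_zero (h : IsHorizontalBasis g K X Y)
    (hK : IsImmersion (𝓡 n) (𝓡 (n + 2)) ∞ (Subtype.val : K → G))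
    (hπ : IsSubmersion (𝓡 (n + 2)) (𝓡 2) ∞ (QuotientGroup.mk : G → G ⧸ K)) (hid : IsIdeal n K)
    (q : G ⧸ K) : planeDet (quotientField 2 K X q) (quotientField 2 K Y q) ≠ 0 := by
  obtain ⟨p, rfl⟩ := QuotientGroup.mk_surjective q
  refine planeDet_ne_zero_of_span fun z => ?_
  obtain ⟨w, rfl⟩ := mfderiv_surjective_of_isSubmersionAt (hπ.isSubmersionAt p) z
  obtain ⟨v, rfl⟩ := exists_mulInvariantVectorField_eq p w
  exact ⟨_, _, h.mfderiv_mk hK hπ hid p v⟩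

/-- The vertical space is the kernel of the differential of the projection. -/
theorem ker_mfderiv_mk (h : IsHorizontalBasis g K X Y)
    (hK : IsImmersion (𝓡 n) (𝓡 (n + 2)) ∞ (Subtype.val : K → G))
    (hπ : IsSubmersion (𝓡 (n + 2)) (𝓡 2) ∞ (QuotientGroup.mk : G → G ⧸ K)) (hid : IsIdeal n K)
    (p : G) :
    LinearMap.ker (mfderiv (𝓡 (n + 2)) (𝓡 2) (QuotientGroup.mk : G → G ⧸ K) p).toLinearMap =
      leafDistribution n K p := by
  ext w
  constructor
  · intro hw
    obtain ⟨v, rfl⟩ := exists_mulInvariantVectorField_eq p w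
    have h1 := (h.mfderiv_mk hK hπ hid p v).symm.trans hw
    have hv := h.sub_mem hK v
    have h0 := eq_zero_of_smul_add_smul_eq_zero (h.planeDet_ne_zero hK hπ hid p) h1
    rw [h0.1, h0.2, zero_smul, zero_smul, add_zero, sub_zero] at hv
    exact mem_leafDistribution hv
  · rintro ⟨v, hv, rfl⟩
    exact mfderiv_mk_mulInvariantVectorField_eq_zero hπ.contMDiff hK.contMDiff hv p

/-- `e₁, e₂` is an orthonormal frame of the surface `(L, h)`. -/
def IsOrthonormalFrame {L : Type*} [TopologicalSpace L] [ChartedSpace (Eucl 2) L]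
    [IsManifold (𝓡 2) ∞ L] (h : Metric 2 L) (e₁ e₂ : ∀ q : L, TangentSpace (𝓡 2) q) : Prop :=
  ∀ q, h.inner q (e₁ q) (e₁ q) = 1 ∧ h.inner q (e₂ q) (e₂ q) = 1 ∧ h.inner q (e₁ q) (e₂ q) = 0

/-- If the projection is a Riemannian submersion, the fields induced by `X` and `Y` are
orthonormal. -/
theorem IsHorizontalBasis.isOrthonormalFrame (hXY : IsHorizontalBasis g K X Y)
    (hg : IsLeftInvariant g)
    (hK : IsImmersion (𝓡 n) (𝓡 (n + 2)) ∞ (Subtype.val : K → G)) (hid : IsIdeal n K)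
    {h : Metric 2 (G ⧸ K)}
    (hh : IsRiemannianSubmersion g h (QuotientGroup.mk : G → G ⧸ K)) :
    IsOrthonormalFrame h (quotientField 2 K X) (quotientField 2 K Y) := by
  intro q
  obtain ⟨p, rfl⟩ := QuotientGroup.mk_surjective q
  have hX := mulInvariantVectorField_mem_orthogonal hg hXY.horizontal_left p
  have hY := mulInvariantVectorField_mem_orthogonal hg hXY.horizontal_right p
  rw [← ker_mfderiv_mk hXY hK hh.submersion hid p] at hX hY
  rw [← mfderiv_mk_mulInvariantVectorField hh.submersion.contMDiff hK.contMDiff (hid X),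
    ← mfderiv_mk_mulInvariantVectorField hh.submersion.contMDiff hK.contMDiff (hid Y),
    hh.isometric p _ _ hX hX, hh.isometric p _ _ hY hY, hh.isometric p _ _ hX hY]
  simp only [hg.inner_mulInvariantVectorField]
  exact ⟨hXY.norm_left, hXY.norm_right, hXY.inner_eq_zero⟩

/-- If the fields induced by `X` and `Y` are orthonormal, the projection is a Riemannian
submersion. -/
theorem IsHorizontalBasis.isRiemannianSubmersion (hXY : IsHorizontalBasis g K X Y)
    (hg : IsLeftInvariant g)
    (hK : IsImmersion (𝓡 n) (𝓡 (n + 2)) ∞ (Subtype.val : K → G))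
    (hπ : IsSubmersion (𝓡 (n + 2)) (𝓡 2) ∞ (QuotientGroup.mk : G → G ⧸ K)) (hid : IsIdeal n K)
    {h : Metric 2 (G ⧸ K)}
    (hh : IsOrthonormalFrame h (quotientField 2 K X) (quotientField 2 K Y)) :
    IsRiemannianSubmersion g h (QuotientGroup.mk : G → G ⧸ K) where
  submersion := hπ
  isometric p v w hv hw := by
    rw [ker_mfderiv_mk hXY hK hπ hid p] at hv hw
    obtain ⟨v, rfl⟩ := exists_mulInvariantVectorField_eq p v
    obtain ⟨w, rfl⟩ := exists_mulInvariantVectorField_eq p w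
    have hv0 := hv _ (mem_leafDistribution (hXY.sub_mem hK w))
    rw [hg.inner_mulInvariantVectorField] at hv0 ⊢
    obtain ⟨h1, h2, h3⟩ := hh p
    have h4 := (h.symm _ _ _).trans h3
    rw [hXY.mfderiv_mk hK hπ hid, hXY.mfderiv_mk hK hπ hid]
    simp only [map_add, map_sub, map_smul, add_apply, smul_apply, smul_eq_mul] at hv0 ⊢
    rw [h1, h2, h3, h4]
    linarith

/-- A metric on a surface is determined by an orthonormal frame. -/
theorem IsOrthonormalFrame.metric_eq {L : Type*} [TopologicalSpace L] [ChartedSpace (Eucl 2) L]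
    [IsManifold (𝓡 2) ∞ L] {h h' : Metric 2 L} {e₁ e₂ : ∀ q : L, TangentSpace (𝓡 2) q}
    (he : ∀ q, planeDet (e₁ q) (e₂ q) ≠ 0) (hh : IsOrthonormalFrame h e₁ e₂)
    (hh' : IsOrthonormalFrame h' e₁ e₂) : h = h' := by
  have key : h.inner = h'.inner := by
    funext q
    ext v w
    obtain ⟨a, b, rfl⟩ : ∃ a b : ℝ, v = a • e₁ q + b • e₂ q := ⟨_, _, planeCoord_smul_add (he q) v⟩
    obtain ⟨c, d, rfl⟩ : ∃ a b : ℝ, w = a • e₁ q + b • e₂ q := ⟨_, _, planeCoord_smul_add (he q) w⟩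
    obtain ⟨h1, h2, h3⟩ := hh q
    have h4 := (h.symm _ _ _).trans h3
    obtain ⟨h1', h2', h3'⟩ := hh' q
    have h4' := (h'.symm _ _ _).trans h3'
    simp only [map_add, map_smul, add_apply, smul_apply, smul_eq_mul, h1, h2, h3, h4, h1', h2',
      h3', h4']
  cases h; cases h'; congr

end LeafSpaceMetric
end LeafSpace

/-! ### Surfaces with a frame such that `[e₁, e₂] = ρ e₁` -/

namespace LeafSpace

open VectorField Filter Topology

section FrameConnection

variable {L : Type*} [TopologicalSpace L] [ChartedSpace (Eucl 2) L] [IsManifold (𝓡 2) ∞ L]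

theorem mdifferentiableAt_inner (h : Metric 2 L) {Z W : ∀ q : L, TangentSpace (𝓡 2) q} {x : L}
    (hZ : FieldDifferentiableAt Z x) (hW : FieldDifferentiableAt W x) :
    MDifferentiableAt (𝓡 2) 𝓘(ℝ) (fun q => h.inner q (Z q) (W q)) x := by
  have h1 : MDifferentiableAt (𝓡 2) ((𝓡 2).prod 𝓘(ℝ))
      (fun q => TotalSpace.mk' ℝ (E := Bundle.Trivial L ℝ) q (h.inner q (Z q) (W q))) x :=
    MDifferentiableAt.clm_bundle_apply₂ (F₁ := Eucl 2) (F₂ := Eucl 2)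
      (h.contMDiff.mdifferentiable (by simp) x) hZ hW
  rw [mdifferentiableAt_totalSpace] at h1
  exact h1.2

theorem contMDiffAt_inner (h : Metric 2 L) {Z W : ∀ q : L, TangentSpace (𝓡 2) q} {x : L}
    (hZ : ContMDiffAt (𝓡 2) (𝓡 2).tangent ∞ (fun q => (⟨q, Z q⟩ : TangentBundle (𝓡 2) L)) x)
    (hW : ContMDiffAt (𝓡 2) (𝓡 2).tangent ∞ (fun q => (⟨q, W q⟩ : TangentBundle (𝓡 2) L)) x) :
    ContMDiffAt (𝓡 2) 𝓘(ℝ) ∞ (fun q => h.inner q (Z q) (W q)) x := by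
  have h1 : ContMDiffAt (𝓡 2) ((𝓡 2).prod 𝓘(ℝ)) ∞
      (fun q => TotalSpace.mk' ℝ (E := Bundle.Trivial L ℝ) q (h.inner q (Z q) (W q))) x :=
    ContMDiffAt.clm_bundle_apply₂ (F₁ := Eucl 2) (F₂ := Eucl 2) (h.contMDiff x) hZ hW
  rw [contMDiffAt_totalSpace] at h1
  exact h1.2

/-- `e₁, e₂` is a smooth orthonormal frame with `[e₁, e₂] = ρ e₁`. -/
structure IsBracketFrame (h : Metric 2 L) (e₁ e₂ : ∀ q : L, TangentSpace (𝓡 2) q) (ρ : ℝ) :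
    Prop where
  contMDiff_left : ContMDiff (𝓡 2) (𝓡 2).tangent ∞
    (fun q => (⟨q, e₁ q⟩ : TangentBundle (𝓡 2) L))
  contMDiff_right : ContMDiff (𝓡 2) (𝓡 2).tangent ∞
    (fun q => (⟨q, e₂ q⟩ : TangentBundle (𝓡 2) L))
  planeDet_ne_zero : ∀ q, planeDet (e₁ q) (e₂ q) ≠ 0
  orthonormal : IsOrthonormalFrame h e₁ e₂
  bracket : ∀ q, mlieBracket (𝓡 2) e₁ e₂ q = ρ • e₁ q

namespace IsBracketFrame

variable {h : Metric 2 L} {e₁ e₂ : ∀ q : L, TangentSpace (𝓡 2) q} {ρ : ℝ}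

theorem inner_left (H : IsBracketFrame h e₁ e₂ ρ) (q : L) (a b : ℝ) :
    h.inner q (a • e₁ q + b • e₂ q) (e₁ q) = a := by
  obtain ⟨h1, h2, h3⟩ := H.orthonormal q
  simp only [map_add, map_smul, add_apply, smul_apply, smul_eq_mul, h1, h.symm q (e₂ q), h3]
  ring

theorem inner_right (H : IsBracketFrame h e₁ e₂ ρ) (q : L) (a b : ℝ) :
    h.inner q (a • e₁ q + b • e₂ q) (e₂ q) = b := by
  obtain ⟨h1, h2, h3⟩ := H.orthonormal q
  simp only [map_add, map_smul, add_apply, smul_apply, smul_eq_mul, h2, h3]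
  ring

theorem expand (H : IsBracketFrame h e₁ e₂ ρ) (q : L) (v : TangentSpace (𝓡 2) q) :
    v = h.inner q v (e₁ q) • e₁ q + h.inner q v (e₂ q) • e₂ q := by
  obtain ⟨a, b, rfl⟩ : ∃ a b : ℝ, v = a • e₁ q + b • e₂ q :=
    ⟨_, _, planeCoord_smul_add (H.planeDet_ne_zero q) v⟩
  rw [H.inner_left, H.inner_right]

theorem inner_eq (H : IsBracketFrame h e₁ e₂ ρ) (q : L) (v w : TangentSpace (𝓡 2) q) :
    h.inner q v w = h.inner q v (e₁ q) * h.inner q w (e₁ q) +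
      h.inner q v (e₂ q) * h.inner q w (e₂ q) := by
  conv_lhs => rw [H.expand q w]
  simp only [map_add, map_smul, smul_eq_mul]
  ring

theorem differentiableAt_left (H : IsBracketFrame h e₁ e₂ ρ) (q : L) :
    FieldDifferentiableAt e₁ q := H.contMDiff_left.mdifferentiable (by simp) q

theorem differentiableAt_right (H : IsBracketFrame h e₁ e₂ ρ) (q : L) :
    FieldDifferentiableAt e₂ q := H.contMDiff_right.mdifferentiable (by simp) q

/-- The bracket of two vector fields in terms of their coefficients. -/
theorem mlieBracket_eq (H : IsBracketFrame h e₁ e₂ ρ) {X Y : ∀ q : L, TangentSpace (𝓡 2) q}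
    {x : L} (hX : FieldDifferentiableAt X x) (hY : FieldDifferentiableAt Y x) :
    mlieBracket (𝓡 2) X Y x =
      (mvfderiv (𝓡 2) (fun q => h.inner q (Y q) (e₁ q)) x (X x) -
        mvfderiv (𝓡 2) (fun q => h.inner q (X q) (e₁ q)) x (Y x) +
        ρ * (h.inner x (X x) (e₁ x) * h.inner x (Y x) (e₂ x) -
          h.inner x (X x) (e₂ x) * h.inner x (Y x) (e₁ x))) • e₁ x +
      (mvfderiv (𝓡 2) (fun q => h.inner q (Y q) (e₂ q)) x (X x) -
        mvfderiv (𝓡 2) (fun q => h.inner q (X q) (e₂ q)) x (Y x)) • e₂ x := by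
  have d1 := H.differentiableAt_left x
  have d2 := H.differentiableAt_right x
  set X1 : L → ℝ := fun q => h.inner q (X q) (e₁ q)
  set X2 : L → ℝ := fun q => h.inner q (X q) (e₂ q)
  set Y1 : L → ℝ := fun q => h.inner q (Y q) (e₁ q)
  set Y2 : L → ℝ := fun q => h.inner q (Y q) (e₂ q)
  have dX1 : MDifferentiableAt (𝓡 2) 𝓘(ℝ) X1 x := mdifferentiableAt_inner h hX d1
  have dX2 : MDifferentiableAt (𝓡 2) 𝓘(ℝ) X2 x := mdifferentiableAt_inner h hX d2
  have dY1 : MDifferentiableAt (𝓡 2) 𝓘(ℝ) Y1 x := mdifferentiableAt_inner h hY d1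
  have dY2 : MDifferentiableAt (𝓡 2) 𝓘(ℝ) Y2 x := mdifferentiableAt_inner h hY d2
  have eX : X = X1 • e₁ + X2 • e₂ := funext fun q => H.expand q (X q)
  have eY : Y = Y1 • e₁ + Y2 • e₂ := funext fun q => H.expand q (Y q)
  have hs {w : L → ℝ} {W : ∀ q : L, TangentSpace (𝓡 2) q} (hw : MDifferentiableAt (𝓡 2) 𝓘(ℝ) w x)
      (hW : FieldDifferentiableAt W x) :
      MDifferentiableAt (𝓡 2) (𝓡 2).tangent
        (fun q => (⟨q, (w • W) q⟩ : TangentBundle (𝓡 2) L)) x :=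
    hw.smul_section hW
  have e21 : mlieBracket (𝓡 2) e₂ e₁ x = -(ρ • e₁ x) := by
    rw [mlieBracket_swap_apply, H.bracket]
  have eXx : X x = X1 x • e₁ x + X2 x • e₂ x := H.expand x (X x)
  have eYx : Y x = Y1 x • e₁ x + Y2 x • e₂ x := H.expand x (Y x)
  change _ = (mvfderiv (𝓡 2) Y1 x (X x) - mvfderiv (𝓡 2) X1 x (Y x) +
      ρ * (X1 x * Y2 x - X2 x * Y1 x)) • e₁ x +
    (mvfderiv (𝓡 2) Y2 x (X x) - mvfderiv (𝓡 2) X2 x (Y x)) • e₂ x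
  rw [eXx, eYx]
  conv_lhs => rw [eX, eY]
  rw [mlieBracket_add_left (hs dX1 d1) (hs dX2 d2), mlieBracket_smul_left dX1 d1,
    mlieBracket_smul_left dX2 d2, mlieBracket_add_right (hs dY1 d1) (hs dY2 d2),
    mlieBracket_add_right (hs dY1 d1) (hs dY2 d2), mlieBracket_smul_right dY1 d1,
    mlieBracket_smul_right dY2 d2, mlieBracket_smul_right dY1 d1, mlieBracket_smul_right dY2 d2,
    e21, H.bracket]
  simp only [Pi.add_apply, Pi.smul_apply', mlieBracket_self, Pi.zero_apply, map_add, map_smul,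
    smul_eq_mul]
  module

/-- The Levi-Civita connection of an orthonormal frame with `[e₁, e₂] = ρ e₁`, determined by
`∇_v e₁ = -ρ ⟨v, e₁⟩ e₂` and `∇_v e₂ = ρ ⟨v, e₁⟩ e₁`. -/
noncomputable def connection (H : IsBracketFrame h e₁ e₂ ρ) : Connection 2 L where
  toFun Z q :=
    (mvfderiv (𝓡 2) (fun q => h.inner q (Z q) (e₁ q)) q +
      (ρ * h.inner q (Z q) (e₂ q)) • h.inner q (e₁ q)).smulRight (e₁ q) +
    (mvfderiv (𝓡 2) (fun q => h.inner q (Z q) (e₂ q)) q -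
      (ρ * h.inner q (Z q) (e₁ q)) • h.inner q (e₁ q)).smulRight (e₂ q)
  isCovariantDerivativeOnUniv :=
    { add := by
        intro Z W x hZ hW _
        have dZ1 := mdifferentiableAt_inner h hZ (H.differentiableAt_left x)
        have dZ2 := mdifferentiableAt_inner h hZ (H.differentiableAt_right x)
        have dW1 := mdifferentiableAt_inner h hW (H.differentiableAt_left x)
        have dW2 := mdifferentiableAt_inner h hW (H.differentiableAt_right x)
        ext v
        simp only [Pi.add_apply, map_add, add_apply, mvfderiv_fun_add dZ1 dW1,
          mvfderiv_fun_add dZ2 dW2, sub_apply, ContinuousLinearMap.smulRight_apply, smul_apply,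
          smul_eq_mul]
        module
      leibniz := by
        intro Z w x hZ hw _
        have dZ1 := mdifferentiableAt_inner h hZ (H.differentiableAt_left x)
        have dZ2 := mdifferentiableAt_inner h hZ (H.differentiableAt_right x)
        ext v
        have eZ : mvfderiv (𝓡 2) w x v • Z x =
            (mvfderiv (𝓡 2) w x v * h.inner x (Z x) (e₁ x)) • e₁ x +
              (mvfderiv (𝓡 2) w x v * h.inner x (Z x) (e₂ x)) • e₂ x := by
          conv_lhs => rw [H.expand x (Z x), smul_add, smul_smul, smul_smul]
        simp only [Pi.smul_apply', map_smul, smul_apply, smul_eq_mul, mvfderiv_fun_mul hw dZ1,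
          mvfderiv_fun_mul hw dZ2, add_apply, sub_apply, ContinuousLinearMap.smulRight_apply]
        rw [eZ]
        module }

theorem connection_apply (H : IsBracketFrame h e₁ e₂ ρ) (Z : ∀ q : L, TangentSpace (𝓡 2) q)
    (q : L) (v : TangentSpace (𝓡 2) q) : H.connection Z q v =
      (mvfderiv (𝓡 2) (fun q => h.inner q (Z q) (e₁ q)) q v +
        ρ * h.inner q (Z q) (e₂ q) * h.inner q v (e₁ q)) • e₁ q +
      (mvfderiv (𝓡 2) (fun q => h.inner q (Z q) (e₂ q)) q v -
        ρ * h.inner q (Z q) (e₁ q) * h.inner q v (e₁ q)) • e₂ q := by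
  rw [h.symm q v (e₁ q)]
  rfl

theorem isLeviCivita_connection (H : IsBracketFrame h e₁ e₂ ρ) : IsLeviCivita h H.connection where
  torsion_free := by
    rw [CovariantDerivative.torsion_eq_zero_iff]
    intro X Y x hX hY
    rw [H.mlieBracket_eq hX hY, H.connection_apply, H.connection_apply]
    module
  metric X Y Z p hY hZ := by
    have dY1 := mdifferentiableAt_inner h hY (H.differentiableAt_left p)
    have dY2 := mdifferentiableAt_inner h hY (H.differentiableAt_right p)
    have dZ1 := mdifferentiableAt_inner h hZ (H.differentiableAt_left p)
    have dZ2 := mdifferentiableAt_inner h hZ (H.differentiableAt_right p)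
    have mul {a b : L → ℝ} (ha : MDifferentiableAt (𝓡 2) 𝓘(ℝ) a p)
        (hb : MDifferentiableAt (𝓡 2) 𝓘(ℝ) b p) :
        MDifferentiableAt (𝓡 2) 𝓘(ℝ) (fun q => a q * b q) p := ha.mul hb
    have e : (fun q => h.inner q (Y q) (Z q)) = fun q =>
        h.inner q (Y q) (e₁ q) * h.inner q (Z q) (e₁ q) +
          h.inner q (Y q) (e₂ q) * h.inner q (Z q) (e₂ q) := funext fun q => H.inner_eq q _ _
    rw [e, mvfderiv_fun_add (mul dY1 dZ1) (mul dY2 dZ2), mvfderiv_fun_mul dY1 dZ1,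
      mvfderiv_fun_mul dY2 dZ2, H.inner_eq p (H.connection Y p (X p)),
      H.inner_eq p (Y p) (H.connection Z p (X p)), H.connection_apply, H.connection_apply,
      H.inner_left, H.inner_left, H.inner_right, H.inner_right]
    simp only [add_apply, smul_apply, smul_eq_mul]
    ring

/-- A surface with an orthonormal frame such that `[e₁, e₂] = ρ e₁` has Gaussian curvature `-ρ ^ 2`.
For `X, Y` with coefficients `Xᵢ, Yᵢ`, one finds
`R(X, Y) Y = -ρ ^ 2 (X₁ Y₂ - X₂ Y₁) (Y₂ e₁ - Y₁ e₂)`. -/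
theorem isGaussianCurvature (H : IsBracketFrame h e₁ e₂ ρ) :
    IsGaussianCurvature h (fun _ => -ρ ^ 2) := by
  refine ⟨H.connection, H.isLeviCivita_connection, fun U hU X Y hX hY p hp => ?_⟩
  replace hX := hX.contMDiffAt (hU.mem_nhds hp)
  replace hY := hY.contMDiffAt (hU.mem_nhds hp)
  have s1 := contMDiffAt_inner h hY H.contMDiff_left.contMDiffAt
  have s2 := contMDiffAt_inner h hY H.contMDiff_right.contMDiffAt
  have hd {Z : ∀ q : L, TangentSpace (𝓡 2) q}
    (hZ : ContMDiffAt (𝓡 2) (𝓡 2).tangent ∞ (fun q => (⟨q, Z q⟩ : TangentBundle (𝓡 2) L)) p) :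
    FieldDifferentiableAt Z p := hZ.mdifferentiableAt (by simp)
  have hbr := H.mlieBracket_eq (hd hX) (hd hY)
  have c1 := mvfderiv_mlieBracket hX hY s1
  have c2 := mvfderiv_mlieBracket hX hY s2
  -- the derivatives of the coefficients of `∇_W Y`
  have key {W : ∀ q : L, TangentSpace (𝓡 2) q} (hW : ContMDiffAt (𝓡 2) (𝓡 2).tangent ∞
      (fun q => (⟨q, W q⟩ : TangentBundle (𝓡 2) L)) p) (v : TangentSpace (𝓡 2) p) :
      mvfderiv (𝓡 2) (fun q => h.inner q (H.connection Y q (W q)) (e₁ q)) p v =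
        mvfderiv (𝓡 2) (fun q => mvfderiv (𝓡 2) (fun q => h.inner q (Y q) (e₁ q)) q (W q)) p v +
          ρ * (h.inner p (Y p) (e₂ p) * mvfderiv (𝓡 2) (fun q => h.inner q (W q) (e₁ q)) p v +
            h.inner p (W p) (e₁ p) * mvfderiv (𝓡 2) (fun q => h.inner q (Y q) (e₂ q)) p v) ∧
      mvfderiv (𝓡 2) (fun q => h.inner q (H.connection Y q (W q)) (e₂ q)) p v =
        mvfderiv (𝓡 2) (fun q => mvfderiv (𝓡 2) (fun q => h.inner q (Y q) (e₂ q)) q (W q)) p v -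
          ρ * (h.inner p (Y p) (e₁ p) * mvfderiv (𝓡 2) (fun q => h.inner q (W q) (e₁ q)) p v +
            h.inner p (W p) (e₁ p) * mvfderiv (𝓡 2) (fun q => h.inner q (Y q) (e₁ q)) p v) := by
    have dW := (contMDiffAt_inner h hW H.contMDiff_left.contMDiffAt).mdifferentiableAt
      (by simp : (∞ : ℕ∞ω) ≠ 0)
    have d1 := s1.mdifferentiableAt (by simp : (∞ : ℕ∞ω) ≠ 0)
    have d2 := s2.mdifferentiableAt (by simp : (∞ : ℕ∞ω) ≠ 0)
    have dd1 := (contMDiffAt_mvfderiv_apply s1 (by simp) hW).mdifferentiableAt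
      (by simp : (∞ : ℕ∞ω) ≠ 0)
    have dd2 := (contMDiffAt_mvfderiv_apply s2 (by simp) hW).mdifferentiableAt
      (by simp : (∞ : ℕ∞ω) ≠ 0)
    have mul {a b : L → ℝ} (ha : MDifferentiableAt (𝓡 2) 𝓘(ℝ) a p)
        (hb : MDifferentiableAt (𝓡 2) 𝓘(ℝ) b p) :
        MDifferentiableAt (𝓡 2) 𝓘(ℝ) (fun q => a q * b q) p := ha.mul hb
    have dρ : MDifferentiableAt (𝓡 2) 𝓘(ℝ) (fun _ : L => ρ) p := mdifferentiableAt_const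
    simp only [H.connection_apply, H.inner_left, H.inner_right]
    rw [mvfderiv_fun_add dd1 (mul (mul dρ d2) dW), mvfderiv_fun_sub dd2 (mul (mul dρ d1) dW),
      mvfderiv_fun_mul (mul dρ d2) dW, mvfderiv_fun_mul dρ d2, mvfderiv_fun_mul (mul dρ d1) dW,
      mvfderiv_fun_mul dρ d1, mvfderiv_const]
    simp only [add_apply, sub_apply, smul_apply, smul_eq_mul, zero_apply]
    constructor <;> ring
  have hR : curvature H.connection X Y Y p =
      (-ρ ^ 2 * (h.inner p (X p) (e₁ p) * h.inner p (Y p) (e₂ p) -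
        h.inner p (X p) (e₂ p) * h.inner p (Y p) (e₁ p)) * h.inner p (Y p) (e₂ p)) • e₁ p +
      (ρ ^ 2 * (h.inner p (X p) (e₁ p) * h.inner p (Y p) (e₂ p) -
        h.inner p (X p) (e₂ p) * h.inner p (Y p) (e₁ p)) * h.inner p (Y p) (e₁ p)) • e₂ p := by
    have b1 := congrArg (fun v => h.inner p v (e₁ p)) hbr
    beta_reduce at b1
    rw [H.inner_left] at b1
    rw [curvature, H.connection_apply (fun q => H.connection Y q (Y q)) p (X p),
      H.connection_apply (fun q => H.connection Y q (X q)) p (Y p),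
      H.connection_apply Y p (mlieBracket (𝓡 2) X Y p), (key hX _).1, (key hX _).2, (key hY _).1,
      (key hY _).2, c1, c2, b1]
    simp only [H.connection_apply, H.inner_left, H.inner_right]
    module
  rw [hR, H.inner_eq p _ (X p), H.inner_left, H.inner_right, H.inner_eq p (X p) (X p),
    H.inner_eq p (Y p) (Y p), H.inner_eq p (X p) (Y p)]
  ring

end IsBracketFrame

end FrameConnection
end LeafSpace

/-! ### The curvature of the leaf space -/

namespace LeafSpace

section LeafSpaceCurvature

variable {n : ℕ} {G : Type*} [TopologicalSpace G] [ChartedSpace (Eucl (n + 2)) G] [Group G]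
  [LieGroup (𝓡 (n + 2)) ∞ G] {K : Subgroup G} [ChartedSpace (Eucl n) K] [LieGroup (𝓡 n) ∞ K]
  [ConnectedSpace K] [ChartedSpace (Eucl 2) (G ⧸ K)] [IsManifold (𝓡 2) ∞ (G ⧸ K)]
  {g : Metric (n + 2) G} {X Y : GroupLieAlgebra (𝓡 (n + 2)) G} {ρ : ℝ}

/-- The frame of the leaf space induced by an adapted frame has the same bracket relation. -/
theorem IsAdaptedFrame.isBracketFrame (hXY : IsAdaptedFrame n g K X Y ρ)
    (hg : IsLeftInvariant g)
    (hK : IsImmersion (𝓡 n) (𝓡 (n + 2)) ∞ (Subtype.val : K → G)) (hid : IsIdeal n K)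
    {h : Metric 2 (G ⧸ K)}
    (hh : IsRiemannianSubmersion g h (QuotientGroup.mk : G → G ⧸ K)) :
    IsBracketFrame h (quotientField 2 K X) (quotientField 2 K Y) ρ where
  contMDiff_left := contMDiff_quotientField hh.submersion hK.contMDiff (hid X)
  contMDiff_right := contMDiff_quotientField hh.submersion hK.contMDiff (hid Y)
  planeDet_ne_zero := hXY.isHorizontalBasis.planeDet_ne_zero hK hh.submersion hid
  orthonormal := hXY.isHorizontalBasis.isOrthonormalFrame hg hK hid hh
  bracket q := by
    obtain ⟨p, rfl⟩ := QuotientGroup.mk_surjective q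
    have h1 := hXY.bracket.2 X hXY.horizontal_left
    have h2 := hXY.bracket.2 Y hXY.horizontal_right
    simp only [map_sub, map_smul, sub_apply, smul_apply, smul_eq_mul, hXY.norm_left,
      hXY.inner_eq_zero] at h1 h2
    rw [mlieBracket_quotientField hh.submersion hK.contMDiff (hid X) (hid Y),
      hXY.isHorizontalBasis.mfderiv_mk hK hh.submersion hid,
      show g.inner 1 ⁅X, Y⁆ X = ρ by linarith, show g.inner 1 ⁅X, Y⁆ Y = 0 by linarith, zero_smul,
      add_zero]

end LeafSpaceCurvature
end LeafSpace

theorem mainTheorem4 (n : ℕ) (G : Type*) [TopologicalSpace G]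
    [ChartedSpace (EuclideanSpace ℝ (Fin (n + 2))) G] [Group G] [LieGroup (𝓡 (n + 2)) ∞ G]
    [ConnectedSpace G]
    (g : LeafSpace.Metric (n + 2) G) (hg : LeafSpace.IsLeftInvariant g)
    (K : Subgroup G) [ChartedSpace (EuclideanSpace ℝ (Fin n)) K] [LieGroup (𝓡 n) ∞ K]
    [ConnectedSpace K]
    (hK : IsSmoothEmbedding (𝓡 n) (𝓡 (n + 2)) ∞ (Subtype.val : K → G))
    (hKc : IsClosed (K : Set G))
    (hKs : LieAlgebra.IsSemisimple ℝ (GroupLieAlgebra (𝓡 n) K))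
    (hF : LeafSpace.IsConformal g (LeafSpace.leafDistribution n K)) :
    ∃ cs : ChartedSpace (EuclideanSpace ℝ (Fin 2)) (G ⧸ K),
    ∃ hcs : LeafSpace.IsLeafSpaceStructure (n := n + 2) K cs,
      (∀ cs' : ChartedSpace (EuclideanSpace ℝ (Fin 2)) (G ⧸ K),
        LeafSpace.IsLeafSpaceStructure (n := n + 2) K cs' →
          LeafSpace.SameSmoothStructure cs' cs) ∧
      haveI := hcs.isManifold
      ∃ h : LeafSpace.Metric 2 (G ⧸ K),
        LeafSpace.IsRiemannianSubmersion g h (QuotientGroup.mk : G → G ⧸ K) ∧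
        (∀ h' : LeafSpace.Metric 2 (G ⧸ K),
          LeafSpace.IsRiemannianSubmersion g h' (QuotientGroup.mk : G → G ⧸ K) → h' = h) ∧
        (∃ (X Y : GroupLieAlgebra (𝓡 (n + 2)) G) (ρ : ℝ),
          LeafSpace.IsAdaptedFrame n g K X Y ρ) ∧
        ∀ (X Y : GroupLieAlgebra (𝓡 (n + 2)) G) (ρ : ℝ),
          LeafSpace.IsAdaptedFrame n g K X Y ρ →
            LeafSpace.IsGaussianCurvature h (fun _ => -ρ ^ 2) ∧ -ρ ^ 2 ≤ 0 := by
  have hKi := hK.isImmersion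
  obtain ⟨cs, hcs⟩ := LeafSpace.exists_isLeafSpaceStructure K hK
  refine ⟨cs, hcs, fun cs' hcs' => hcs'.sameSmoothStructure hcs, ?_⟩
  have := hcs.isManifold
  have hπ := hcs.submersion
  have hid : LeafSpace.IsIdeal n K := fun v U hU =>
    LeafSpace.lie_mem_lieAlgebraOf_of_isConformal hg hF hKi hKs hU v
  obtain ⟨X, Y, ρ, hXY⟩ := LeafSpace.exists_isAdaptedFrame g hKi
  have hdet := hXY.isHorizontalBasis.planeDet_ne_zero hKi hπ hid
  obtain ⟨h, hh⟩ := LeafSpace.exists_metric_of_frame hdet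
    (LeafSpace.contMDiff_quotientField hπ hKi.contMDiff (hid X))
    (LeafSpace.contMDiff_quotientField hπ hKi.contMDiff (hid Y))
  have hsub := hXY.isHorizontalBasis.isRiemannianSubmersion hg hKi hπ hid hh
  refine ⟨h, hsub, fun h' hsub' => ?_, ⟨X, Y, ρ, hXY⟩, fun X' Y' ρ' hXY' => ⟨?_, ?_⟩⟩
  · exact (hXY.isHorizontalBasis.isOrthonormalFrame hg hKi hid hsub').metric_eq hdet hh
  · exact (hXY'.isBracketFrame hg hKi hid hsub).isGaussianCurvature
  · exact neg_nonpos.2 (sq_nonneg ρ')
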